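/- Let $\mathfrak g$ be a finite-dimensional reductive Lie algebra over $\mathbb C$, $\mathfrak h$ a Cartan subalgebra, $\Phi\subset\mathfrak h^*$ the set of roots, and $I\subset\Phi$ a system of simple roots. Assume that $\mathfrak g$ is simply laced, i.e. the Cartan integers of distinct simple roots are $0$ or $-1$; two distinct simple roots are called connected if they are joined by an edge of the Dynkin diagram. For every $\alpha\in\Phi$ fix a nonzero root vector $X_\alpha\in\mathfrak g_\alpha$. Call two elements of $\mathfrak g$ conjugate if they lie in the same orbit of the adjoint group, i.e. the group generated by all $\exp(\operatorname{ad}x)$ with $x\in\mathfrak g$ and $\operatorname{ad}x$ nilpotent (this is $\operatorname{Ad}(G)$ for every connected reductive group $G$ over $\mathbb C$ with Lie algebra $\mathfrak g$). Let $J_1,J_2\subseteq I$ be disjoint. The vertices in $J_1$ are labelled $+$, those in $J_2$ are labelled $-$. Types $E_6$ and $E_8$ are numbered as in Bourbaki: the chain $1-3-4-5-6(-7-8)$ with $2$ attached to $4$. A vertex connected to a subdiagram means a simple root outside the subdiagram that is connected to one of its vertices. 1. Suppose that $\alpha\in J_1$, $\beta\in J_2$ form a subdiagram $A_2$, and that all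 simple roots connected to this subdiagram lie in $J_1$. Then $\sum_{\gamma\in J_1}X_\gamma+\sum_{\delta\in J_2}X_{-\delta}$ is conjugate to $\sum_{\gamma\in J_1}X_\gamma+\sum_{\delta\in J_2\setminus\{\beta\}}X_{-\delta}$. 2. Suppose that $\alpha_1,\alpha_2\in J_1$ and $\beta_1,\beta_2\in J_2$ are such that $\alpha_1-\alpha_2-\beta_1-\beta_2$ form, in this order, a subdiagram $A_4$, and that all simple roots connected to this subdiagram lie in $J_1$. Then $\sum_{\gamma\in J_1}X_\gamma+\sum_{\delta\in J_2}X_{-\delta}$ is conjugate to $\sum_{\gamma\in J_1}X_\gamma+\sum_{\delta\in J_2\setminus\{\beta_1\}}X_{-\delta}$. 3. Suppose that $\alpha_1,\alpha_2,\alpha_3\in J_1$ and $\beta_1,\beta_2,\beta_3\in J_2$ are such that $\alpha_1-\alpha_2-\alpha_3-\beta_1-\beta_2-\beta_3$ form, in this order, a subdiagram $A_6$, and that all simple roots connected to this subdiagram lie in $J_1$. Then $\sum_{\gamma\in J_1}X_\gamma+\sum_{\delta\in J_2}X_{-\delta}$ is conjugate to $\sum_{\gamma\in J_1}X_\gamma+\sum_{\delta\in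 J_2\setminus\{\beta_1\}}X_{-\delta}$. 4. Suppose that $\alpha_1,\alpha_2,\alpha_3\in J_1$ and $\beta_1,\beta_2,\beta_3\in J_2$ are such that $\beta_1,\beta_2,\beta_3,\alpha_1,\alpha_2,\alpha_3$ are the vertices $1,2,3,4,5,6$ of a subdiagram $E_6$ (so the edges are $\beta_1-\beta_3-\alpha_1-\alpha_2-\alpha_3$ and $\beta_2-\alpha_1$), that no simple root outside this subdiagram is connected to $\beta_1$, and that all simple roots connected to this subdiagram lie in $J_1$. Then $\sum_{\gamma\in J_1}X_\gamma+\sum_{\delta\in J_2}X_{-\delta}$ is conjugate to $\sum_{\gamma\in J_1}X_\gamma+\sum_{\delta\in J_2\setminus\{\beta_2\}}X_{-\delta}$. 5. Suppose that the Dynkin diagram of $\mathfrak g$ is of type $E_8$ with simple roots $\alpha_1,\dots,\alpha_8$, that $J_1=\{\alpha_1,\alpha_2,\alpha_3,\alpha_4\}$ and $J_2=\{\alpha_5,\alpha_6,\alpha_7,\alpha_8\}$. Then $\sum_{\gamma\in J_1}X_\gamma+\sum_{\delta\in J_2}X_{-\delta}$ is conjugate to $\sum_{\gamma\in J_1}X_\gamma+\sum_{\delta\in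 J_2\setminus\{\alpha_5\}}X_{-\delta}$. The same holds with the roles of $J_1$ and $J_2$ interchanged: if one of the hypotheses 1–5 holds with $J_1$ and $J_2$ exchanged, and $\beta\in J_1$ is the corresponding simple root, then $\sum_{\gamma\in J_1}X_\gamma+\sum_{\delta\in J_2}X_{-\delta}$ is conjugate to $\sum_{\gamma\in J_1\setminus\{\beta\}}X_\gamma+\sum_{\delta\in J_2}X_{-\delta}$. -/

import Mathlib

noncomputable section

namespace LiePattern

open LieAlgebra

variable {𝔤 : Type*} [LieRing 𝔤] [LieAlgebra ℂ 𝔤]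

/-! ### The adjoint group -/

/-- `exp D = ∑ D ^ k / k!` for a nilpotent endomorphism `D`; the sum stops at the nilpotency
class of `D`, beyond which all powers vanish. -/
def nilExp {V : Type*} [AddCommGroup V] [Module ℂ V] (D : Module.End ℂ V) : Module.End ℂ V :=
  ∑ k ∈ Finset.range (nilpotencyClass D), ((k.factorial : ℂ)⁻¹) • D ^ k

variable (𝔤) in
/-- The adjoint group `Int 𝔤` of inner automorphisms: the subgroup of `GL(𝔤)` generated by all
`exp (ad x)` with `ad x` nilpotent. When `𝔤` is the Lie algebra of a connected reductive group `G`
over `ℂ`, this is the image `Ad(G)` of the adjoint representation. -/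
def adjointGroup : Subgroup (𝔤 ≃ₗ[ℂ] 𝔤) :=
  Subgroup.closure
    {g | ∃ x : 𝔤, IsNilpotent (LieAlgebra.ad ℂ 𝔤 x) ∧
      (g : Module.End ℂ 𝔤) = nilExp (LieAlgebra.ad ℂ 𝔤 x)}

/-- Two elements of `𝔤` are conjugate if they lie in one orbit of the adjoint group. -/
def AreConjugate (x y : 𝔤) : Prop :=
  ∃ g ∈ adjointGroup 𝔤, g x = y

/-! ### Roots, coroots, simple roots -/

variable [FiniteDimensional ℂ 𝔤] {H : LieSubalgebra ℂ 𝔤} [H.IsCartanSubalgebra]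

/-- `α` is a root of `𝔤` with respect to `H`. -/
def IsRoot (α : Module.Dual ℂ H) : Prop :=
  α ≠ 0 ∧ rootSpace H α ≠ ⊥

/-- The coroot of a root `α`: the (unique) `h ∈ ⁅𝔤_α, 𝔤_{-α}⁆` with `α h = 2`. -/
def coroot (α : Module.Dual ℂ H) : H :=
  Classical.epsilon fun h : H => h ∈ corootSpace (⇑α) ∧ α h = 2

/-- A choice of a nonzero root vector `X α ∈ 𝔤_α` for every root `α`. -/
def IsRootVectors (X : Module.Dual ℂ H → 𝔤) : Prop :=
  ∀ α, IsRoot α → X α ∈ rootSpace H α ∧ X α ≠ 0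

variable {I : Type*} [Fintype I]

/-- `Δ : I → H*` is a system of simple roots. -/
structure IsSimpleSystem (Δ : I → Module.Dual ℂ H) : Prop where
  isRoot : ∀ i, IsRoot (Δ i)
  linearIndependent : LinearIndependent ℂ Δ
  pos_or_neg : ∀ β, IsRoot β →
    ∃ n : I → ℕ, β = ∑ i, n i • Δ i ∨ β = -∑ i, n i • Δ i

/-! ### The Dynkin diagram -/

/-- The Cartan integer `⟨Δ j, (Δ i)^∨⟩`. -/
def cartanInt (Δ : I → Module.Dual ℂ H) (i j : I) : ℂ :=
  Δ j (coroot (Δ i))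

/-- All edges of the Dynkin diagram are simple edges. -/
def IsSimplyLaced (Δ : I → Module.Dual ℂ H) : Prop :=
  ∀ i j, i ≠ j → cartanInt Δ i j = 0 ∨ cartanInt Δ i j = -1

/-- `i` and `j` are joined by an edge of the Dynkin diagram. -/
def Connected (Δ : I → Module.Dual ℂ H) (i j : I) : Prop :=
  i ≠ j ∧ cartanInt Δ i j ≠ 0

/-- The vertices `f 0, f 1, …`, in this order, form a full subdiagram of the Dynkin diagram
with Cartan matrix `A`. -/
def FormsDiagram (Δ : I → Module.Dual ℂ H) {n : ℕ} (f : Fin n → I)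
    (A : Matrix (Fin n) (Fin n) ℤ) : Prop :=
  Function.Injective f ∧ ∀ k l, cartanInt Δ (f k) (f l) = (A k l : ℂ)

/-- Every vertex outside `f 0, f 1, …` which is connected to one of them lies in `J`. -/
def NeighboursIn (Δ : I → Module.Dual ℂ H) {n : ℕ} (f : Fin n → I) (J : Finset I) : Prop :=
  ∀ i, i ∉ Set.range f → (∃ k, Connected Δ i (f k)) → i ∈ J

variable [DecidableEq I]

/-- The labelled patterns. `Pattern Δ P N β` says that the Dynkin diagram whose vertices in `P` are
labelled `+` and whose vertices in `N` are labelled `-` contains one of the five patterns, and that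
`β ∈ N` is the vertex which the pattern allows to remove. Types `E₆` and `E₈` are numbered
as in Bourbaki (chain `1-3-4-5-⋯`, with `2` attached to `4`). -/
inductive Pattern (Δ : I → Module.Dual ℂ H) (P N : Finset I) : I → Prop
  | A₂ (α β : I) (hα : α ∈ P) (hβ : β ∈ N)
      (type : FormsDiagram Δ ![α, β] (CartanMatrix.A 2))
      (nbr : NeighboursIn Δ ![α, β] P) : Pattern Δ P N β
  | A₄ (α₁ α₂ β₁ β₂ : I) (hα : {α₁, α₂} ⊆ P) (hβ : {β₁, β₂} ⊆ N)
      (type : FormsDiagram Δ ![α₁, α₂, β₁, β₂] (CartanMatrix.A 4))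
      (nbr : NeighboursIn Δ ![α₁, α₂, β₁, β₂] P) : Pattern Δ P N β₁
  | A₆ (α₁ α₂ α₃ β₁ β₂ β₃ : I) (hα : {α₁, α₂, α₃} ⊆ P) (hβ : {β₁, β₂, β₃} ⊆ N)
      (type : FormsDiagram Δ ![α₁, α₂, α₃, β₁, β₂, β₃] (CartanMatrix.A 6))
      (nbr : NeighboursIn Δ ![α₁, α₂, α₃, β₁, β₂, β₃] P) : Pattern Δ P N β₁
  | E₆ (β₁ β₂ β₃ α₁ α₂ α₃ : I) (hα : {α₁, α₂, α₃} ⊆ P) (hβ : {β₁, β₂, β₃} ⊆ N)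
      (type : FormsDiagram Δ ![β₁, β₂, β₃, α₁, α₂, α₃] CartanMatrix.E₆)
      (nbr : NeighboursIn Δ ![β₁, β₂, β₃, α₁, α₂, α₃] P)
      (nbr₁ : ∀ i, i ∉ Set.range ![β₁, β₂, β₃, α₁, α₂, α₃] → ¬ Connected Δ i β₁) :
      Pattern Δ P N β₂
  | E₈ (α₁ α₂ α₃ α₄ α₅ α₆ α₇ α₈ : I)
      (type : FormsDiagram Δ ![α₁, α₂, α₃, α₄, α₅, α₆, α₇, α₈] CartanMatrix.E₈)
      (all : Set.range ![α₁, α₂, α₃, α₄, α₅, α₆, α₇, α₈] = Set.univ)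
      (hP : P = {α₁, α₂, α₃, α₄}) (hN : N = {α₅, α₆, α₇, α₈}) : Pattern Δ P N α₅

/-- The element `∑_{γ ∈ P} X_γ + ∑_{δ ∈ N} X_{-δ}`. -/
def signedSum (X : Module.Dual ℂ H → 𝔤) (Δ : I → Module.Dual ℂ H) (P N : Finset I) : 𝔤 :=
  ∑ γ ∈ P, X (Δ γ) + ∑ δ ∈ N, X (-Δ δ)

end LiePattern

end

set_option linter.unusedSectionVars false

noncomputable section

namespace LiePattern

open LieAlgebra LieModule

section

/-! ### Exponentials of nilpotent endomorphisms -/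

section NilExp

variable {V : Type*} [AddCommGroup V] [Module ℂ V]

/-! Write the signed sum as `e + x`, where `x` is the root vector at the vertex to be removed and
`e` is the sum of the others.

For the patterns A₂, A₄, A₆, E₆ one exponential suffices: if `⁅u, e⁆ = -x` and `⁅u, x⁆ = 0`, then
`exp (ad u)` sends `e + x` to `e` (`areConjugate_sub`). Such a `u` is built recursively: divide by
one positive simple root vector, then correct the brackets of the result with the remaining summands
in the same way. The recursion needs only that certain weights are not roots and that certain Cartan
pairings are nonzero. Both are read off the Cartan matrix, so it becomes the decidable predicate
`Killable`, made into Lie algebra by `Killable.exists_lie_eq`.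

For E₈, `e` is the nilpositive element of an `sl₂`-triple commuting with the fundamental coweight
`t` at the removed vertex, and `x` has weight 3 under the neutral element. Since `ad e` is onto in
positive weights, the error can be pushed step by step into more negative eigenspaces of `t` until
it vanishes (`areConjugate_add_of_isSl2Triple`).

The root theory of a reductive algebra is transported from its quotient by the centre, which is
semisimple. Exchanging the two labels amounts to replacing `Δ` by `-Δ`. -/

lemma nilExp_eq_sum {D : Module.End ℂ V} {n : ℕ} (h : D ^ n = 0) :
    nilExp D = ∑ k ∈ Finset.range n, ((k.factorial : ℂ)⁻¹) • D ^ k := by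
  have hle : nilpotencyClass D ≤ n := csInf_le' h
  refine Finset.sum_subset (by simpa using hle) fun k _ hk ↦ ?_
  rw [pow_eq_zero_of_le (by simpa using hk) (pow_nilpotencyClass ⟨n, h⟩), smul_zero]

lemma nilExp_mul_nilExp_neg {D : Module.End ℂ V} (h : IsNilpotent D) :
    nilExp D * nilExp (-D) = 1 := by
  -- `IsNilpotent.exp` has rational coefficients, so `V` is also viewed as a rational vector space.
  let _ : Module ℚ V := Module.compHom V (algebraMap ℚ ℂ)
  have key (D : Module.End ℂ V) : nilExp D = IsNilpotent.exp D := by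
    refine Finset.sum_congr rfl fun k _ ↦ ?_
    ext v
    change _ = (algebraMap ℚ ℂ) ((k.factorial : ℚ)⁻¹) • (D ^ k) v
    simp
  rw [key, key, IsNilpotent.exp_mul_exp_neg_self h]

lemma nilExp_apply_sub_mem {D : Module.End ℂ V} (h : IsNilpotent D) {W : Submodule ℂ V}
    (hW : ∀ w ∈ W, D w ∈ W) {x : V} (hx : D (D x) ∈ W) : nilExp D x - (x + D x) ∈ W := by
  obtain ⟨n, hn⟩ := h
  have hpow (k : ℕ) : (D ^ (k + 2)) x ∈ W := by
    induction k with
    | zero => simpa [pow_succ] using hx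
    | succ k ih =>
      rw [show k + 1 + 2 = (k + 2) + 1 by ring, pow_succ', Module.End.mul_apply]
      exact hW _ ih
  rw [nilExp_eq_sum (n := n + 2) (by rw [pow_add, hn, zero_mul]), Finset.sum_range_succ',
    Finset.sum_range_succ']
  simp only [LinearMap.add_apply, LinearMap.sum_apply, LinearMap.smul_apply]
  have : (∑ k ∈ Finset.range n, (((k + 1 + 1).factorial : ℂ)⁻¹) • (D ^ (k + 1 + 1)) x) ∈ W :=
    W.sum_mem fun k _ ↦ W.smul_mem _ (hpow k)
  convert this using 1
  simp
  abel

end NilExp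

/-! ### Conjugation by exponentials -/

variable {𝔤 : Type*} [LieRing 𝔤] [LieAlgebra ℂ 𝔤]

lemma areConjugate_refl (x : 𝔤) : AreConjugate x x :=
  ⟨1, one_mem _, rfl⟩

lemma AreConjugate.trans {x y z : 𝔤} (h₁ : AreConjugate x y) (h₂ : AreConjugate y z) :
    AreConjugate x z := by
  obtain ⟨g₁, hg₁, rfl⟩ := h₁
  obtain ⟨g₂, hg₂, rfl⟩ := h₂
  exact ⟨g₂ * g₁, mul_mem hg₂ hg₁, rfl⟩

lemma areConjugate_nilExp {u : 𝔤} (hu : IsNilpotent (ad ℂ 𝔤 u)) (x : 𝔤) :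
    AreConjugate x (nilExp (ad ℂ 𝔤 u) x) := by
  have h₁ := nilExp_mul_nilExp_neg hu
  have h₂ := nilExp_mul_nilExp_neg hu.neg
  rw [neg_neg] at h₂
  exact ⟨.ofLinearMap (nilExp (ad ℂ 𝔤 u)) (nilExp (-ad ℂ 𝔤 u)) h₁ h₂,
    Subgroup.subset_closure ⟨u, hu, rfl⟩, rfl⟩

variable [FiniteDimensional ℂ 𝔤]

/-- Otherwise all powers of `ad u` would be nonzero eigenvectors of the commutator with `ad t`, with
the infinitely many eigenvalues `n * c`. Every exponent used below is an eigenvector of a coweight,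
so this supplies its nilpotency. -/
lemma isNilpotent_ad_of_lie_eq_smul {t u : 𝔤} {c : ℂ} (hc : c ≠ 0) (h : ⁅t, u⁆ = c • u) :
    IsNilpotent (ad ℂ 𝔤 u) := by
  by_contra hu
  set D := ad ℂ 𝔤 u with hD
  set T := ad ℂ 𝔤 t with hT
  have hTD : T * D - D * T = c • D := by
    ext x
    simp [hD, hT, Module.End.mul_apply, leibniz_lie t u x, h]
  have hpow (n : ℕ) : T * D ^ n - D ^ n * T = (n * c) • D ^ n := by
    induction n with
    | zero => simp
    | succ n ih =>
      calc T * D ^ (n + 1) - D ^ (n + 1) * T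
          = (T * D ^ n - D ^ n * T) * D + D ^ n * (T * D - D * T) := by rw [pow_succ]; noncomm_ring
        _ = _ := by rw [ih, hTD, pow_succ]; push_cast; rw [add_mul, add_smul]; simp
  let F : Module.End ℂ (Module.End ℂ 𝔤) := LinearMap.mulLeft ℂ T - LinearMap.mulRight ℂ T
  have hev (n : ℕ) : F.HasEigenvalue (n * c) :=
    Module.End.hasEigenvalue_of_hasEigenvector (x := D ^ n)
      ⟨by simpa [F, Module.End.mem_eigenspace_iff] using hpow n, fun h0 ↦ hu ⟨n, h0⟩⟩
  refine Set.infinite_of_injective_forall_mem (f := fun n : ℕ ↦ (n : ℂ) * c) (fun a b hab ↦ ?_) hev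
    F.finite_hasEigenvalue
  simpa [hc] using hab

/-- One conjugation step: if `u` sends `x` to `-y` and kills `y`, then `exp (ad u)` sends `x` to
`x - y`. -/
lemma areConjugate_sub {t u x y : 𝔤} {c : ℂ} (hc : c ≠ 0) (h : ⁅t, u⁆ = c • u)
    (hx : ⁅u, x⁆ = -y) (hy : ⁅u, y⁆ = 0) : AreConjugate x (x - y) := by
  have hu := isNilpotent_ad_of_lie_eq_smul hc h
  have := nilExp_apply_sub_mem hu (W := ⊥) (x := x) (by simp) (by simp [hx, hy])
  rw [Submodule.mem_bot, sub_eq_zero] at this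
  have h2 := areConjugate_nilExp hu x
  rwa [this, ad_apply, hx, ← sub_eq_add_neg] at h2

/-! ### Surjectivity of the nilpositive element in positive weights -/

section Sl2

variable {h e f : 𝔤}

/-- If the double bracket vanished, then `f` would send `e ^ (k + 1) v` to a nonzero multiple of `e
^ k v`. So no `e ^ k v` would vanish, giving infinitely many eigenvalues `m + 2 * k` of `ad h`. This
avoids complete reducibility. -/
lemma _root_.IsSl2Triple.lie_e_lie_f_ne_zero (ht : IsSl2Triple h e f) {m : ℕ} (hm : 0 < m) {v : 𝔤}
    (hv : ⁅h, v⁆ = (m : ℂ) • v) (hv0 : v ≠ 0) : ⁅e, ⁅f, v⁆⁆ ≠ 0 := by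
  intro hef
  have hhe (k : ℕ) : ⁅h, ((ad ℂ 𝔤 e) ^ k) v⁆ = (m + 2 * k : ℂ) • ((ad ℂ 𝔤 e) ^ k) v := by
    induction k with
    | zero => simpa using hv
    | succ k ih =>
      rw [pow_succ', Module.End.mul_apply, ad_apply, leibniz_lie, ih, ht.lie_h_e_smul ℂ, smul_lie,
        lie_smul, ← add_smul]
      push_cast
      ring_nf
  have hfe (k : ℕ) : ⁅f, ((ad ℂ 𝔤 e) ^ (k + 1)) v⁆ =
      (-((k + 1 : ℂ) * (m + k))) • ((ad ℂ 𝔤 e) ^ k) v := by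
    have step (w : 𝔤) : ⁅f, ⁅e, w⁆⁆ = ⁅e, ⁅f, w⁆⁆ - ⁅h, w⁆ := by
      rw [← ht.lie_e_f, lie_lie]; abel
    induction k with
    | zero => simp [step, hef, hv]
    | succ k ih =>
      rw [pow_succ' _ (k + 1), Module.End.mul_apply, ad_apply, step, ih, hhe, lie_smul, ← ad_apply ℂ,
        ← Module.End.mul_apply, ← pow_succ', ← sub_smul]
      push_cast
      ring_nf
  have hne (k : ℕ) : ((ad ℂ 𝔤 e) ^ k) v ≠ 0 := by
    induction k with
    | zero => simpa using hv0
    | succ k ih =>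
      intro h0
      have := hfe k
      rw [h0, lie_zero, eq_comm, smul_eq_zero, neg_eq_zero, mul_eq_zero] at this
      refine this.elim (fun h ↦ h.elim ?_ ?_) ih
      · exact_mod_cast k.succ_ne_zero
      · exact_mod_cast (by lia : m + k ≠ 0)
  have hev (k : ℕ) : (ad ℂ 𝔤 h).HasEigenvalue (m + 2 * k : ℂ) :=
    Module.End.hasEigenvalue_of_hasEigenvector (x := ((ad ℂ 𝔤 e) ^ k) v)
      ⟨by simpa [Module.End.mem_eigenspace_iff] using hhe k, hne k⟩
  refine Set.infinite_of_injective_forall_mem (f := fun k : ℕ ↦ (m + 2 * k : ℂ)) (fun a b hab ↦ ?_)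
    hev (ad ℂ 𝔤 h).finite_hasEigenvalue
  simpa using hab

/-- For an `sl₂`-triple `(h, e, f)`, `ad e` maps onto the positive weight spaces of `ad h`, also
within an eigenspace of `ad t` when `t` commutes with the triple. -/
lemma _root_.IsSl2Triple.exists_lie_e_eq (ht : IsSl2Triple h e f) {t : 𝔤} (hte : ⁅t, e⁆ = 0)
    (htf : ⁅t, f⁆ = 0) {m : ℕ} (hm : 0 < m) {c : ℂ} {r : 𝔤} (hr : ⁅h, r⁆ = (m : ℂ) • r)
    (htr : ⁅t, r⁆ = c • r) :
    ∃ u, ⁅h, u⁆ = (m - 2 : ℂ) • u ∧ ⁅t, u⁆ = c • u ∧ ⁅e, u⁆ = r := by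
  let E : Submodule ℂ 𝔤 := (ad ℂ 𝔤 h).eigenspace m ⊓ (ad ℂ 𝔤 t).eigenspace c
  have mem {x : 𝔤} : x ∈ E ↔ ⁅h, x⁆ = (m : ℂ) • x ∧ ⁅t, x⁆ = c • x := by
    simp [E]
  have hf {x : 𝔤} (hx : x ∈ E) : ⁅h, ⁅f, x⁆⁆ = (m - 2 : ℂ) • ⁅f, x⁆ ∧ ⁅t, ⁅f, x⁆⁆ = c • ⁅f, x⁆ := by
    rw [mem] at hx
    constructor
    · rw [leibniz_lie, hx.1, ht.lie_lie_smul_f ℂ, neg_lie, smul_lie, lie_smul]; module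
    · rw [leibniz_lie, htf, hx.2, zero_lie, zero_add, lie_smul]
  have hE : ∀ x ∈ E, (ad ℂ 𝔤 e ∘ₗ ad ℂ 𝔤 f) x ∈ E := by
    intro x hx
    obtain ⟨h₁, h₂⟩ := hf hx
    rw [mem]
    simp only [LinearMap.comp_apply, ad_apply]
    constructor
    · rw [leibniz_lie, h₁, ht.lie_h_e_smul ℂ, smul_lie, lie_smul]; module
    · rw [leibniz_lie, hte, h₂, zero_lie, zero_add, lie_smul]
  -- `ad e ∘ ad f` preserves the joint eigenspace `E`; in finite dimension its injectivity there
  -- gives surjectivity.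
  have hinj : Function.Injective ((ad ℂ 𝔤 e ∘ₗ ad ℂ 𝔤 f).restrict hE) := by
    rw [← LinearMap.ker_eq_bot, LinearMap.ker_eq_bot']
    rintro ⟨x, hx⟩ h0
    by_contra hx0
    refine ht.lie_e_lie_f_ne_zero hm (mem.1 hx).1 (fun h ↦ hx0 (by simp [h])) ?_
    simpa using congrArg Subtype.val h0
  obtain ⟨⟨x, hx⟩, hxr⟩ := LinearMap.injective_iff_surjective.1 hinj ⟨r, mem.2 ⟨hr, htr⟩⟩
  exact ⟨⁅f, x⁆, (hf hx).1, (hf hx).2, by simpa using congrArg Subtype.val hxr⟩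

end Sl2

end

/-! ### Reduction to the semisimple quotient by the centre -/

section

variable {𝔤 : Type*} [LieRing 𝔤] [LieAlgebra ℂ 𝔤]

lemma lieSubmodule_ne_bot_iff {L M : Type*} [LieRing L] [LieAlgebra ℂ L] [AddCommGroup M]
    [Module ℂ M] [LieRingModule L M] {N : LieSubmodule ℂ L M} : N ≠ ⊥ ↔ ∃ x ∈ N, x ≠ 0 := by
  rw [ne_eq, LieSubmodule.eq_bot_iff]
  push Not
  rfl

section Quotient

variable {Q : Type*} [LieRing Q] [LieAlgebra ℂ Q] {π : 𝔤 →ₗ⁅ℂ⁆ Q}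

/-- The preimage of an abelian ideal has its derived ideal in the centre, so it is solvable and lies
in the radical, which is the centre. -/
lemma hasTrivialRadical_of_ker_eq_center [FiniteDimensional ℂ 𝔤] [HasCentralRadical ℂ 𝔤]
    (hπ : Function.Surjective π) (hker : ∀ x, π x = 0 ↔ x ∈ center ℂ 𝔤) :
    HasTrivialRadical ℂ Q := by
  rw [hasTrivialRadical_iff_no_abelian_ideals]
  intro I hI
  set J : LieIdeal ℂ 𝔤 := I.comap π with hJ
  have hJJ : ⁅J, J⁆ ≤ center ℂ 𝔤 := by
    rw [LieSubmodule.lie_le_iff]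
    intro x hx y hy
    rw [hJ, LieIdeal.mem_comap] at hx hy
    rw [← hker, LieHom.map_lie]
    simpa using congrArg Subtype.val (hI.trivial ⟨π x, hx⟩ ⟨π y, hy⟩)
  have hJs : IsSolvable J := by
    refine IsSolvable.mk (R := ℂ) (k := 2) ((LieIdeal.derivedSeries_eq_bot_iff J 2).2 ?_)
    rw [derivedSeriesOfIdeal_succ, derivedSeriesOfIdeal_succ, derivedSeriesOfIdeal_zero,
      eq_bot_iff, LieSubmodule.lie_le_iff]
    intro x hx y hy
    simpa using hJJ hy x
  have hJc : J ≤ center ℂ 𝔤 := by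
    rw [← HasCentralRadical.radical_eq_center (R := ℂ) (L := 𝔤)]
    exact (LieIdeal.solvable_iff_le_radical ℂ 𝔤 J).1 hJs
  rw [eq_bot_iff]
  intro y hy
  obtain ⟨x, rfl⟩ := hπ y
  simpa using (hker x).2 (hJc (show x ∈ J by simpa [hJ, LieIdeal.mem_comap] using hy))

variable {H : LieSubalgebra ℂ 𝔤}

variable (π H) in
/-- The restriction of a homomorphism of Lie algebras to a subalgebra and its image. -/
def restrictHom : H →ₗ⁅ℂ⁆ H.map π where
  toFun h := ⟨π h, (LieSubalgebra.mem_map _ _ _).2 ⟨h, h.2, rfl⟩⟩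
  map_add' _ _ := by ext; simp
  map_smul' _ _ := by ext; simp
  map_lie' := by intro _ _; ext; simp

@[simp] lemma coe_restrictHom (h : H) : (restrictHom π H h : Q) = π h := rfl

lemma restrictHom_surjective : Function.Surjective (restrictHom π H) := by
  rintro ⟨_, h, hh, rfl⟩
  exact ⟨⟨h, hh⟩, rfl⟩

lemma isCartanSubalgebra_map [H.IsCartanSubalgebra] (hπ : Function.Surjective π)
    (hker : ∀ x, π x = 0 ↔ x ∈ center ℂ 𝔤) : (H.map π).IsCartanSubalgebra where
  nilpotent := (restrictHom_surjective (π := π) (H := H)).lieAlgebra_isNilpotent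
  self_normalizing := by
    have mem_H {x : 𝔤} (hx : ∀ y ∈ H, ⁅x, y⁆ ∈ H) : x ∈ H := by
      rw [← LieSubalgebra.IsCartanSubalgebra.self_normalizing (H := H), LieSubalgebra.mem_normalizer_iff]
      exact hx
    -- A self-normalizing subalgebra contains the centre, so normalizing the image of `H` lifts to
    -- normalizing `H`.
    have hZ {z : 𝔤} (hz : z ∈ center ℂ 𝔤) : z ∈ H := by
      refine mem_H fun y _ ↦ ?_
      rw [← lie_skew, hz y, neg_zero]
      exact H.zero_mem
    refine le_antisymm (fun y hy ↦ ?_) (LieSubalgebra.le_normalizer _)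
    obtain ⟨x, rfl⟩ := hπ y
    refine (LieSubalgebra.mem_map _ _ _).2 ⟨x, mem_H fun h hh ↦ ?_, rfl⟩
    rw [LieSubalgebra.mem_normalizer_iff] at hy
    obtain ⟨h', hh', e⟩ := hy (π h) ((LieSubalgebra.mem_map _ _ _).2 ⟨h, hh, rfl⟩)
    have hd : h' - ⁅x, h⁆ ∈ center ℂ 𝔤 := by
      rw [← hker, map_sub, sub_eq_zero, LieHom.map_lie]
      exact e
    simpa using H.sub_mem hh' (hZ hd)

variable [H.IsCartanSubalgebra]

lemma eq_zero_of_mem_rootSpace_of_mem_center {χ : H → ℂ} {h : H} (hχ : χ h ≠ 0) {x : 𝔤}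
    (hx : x ∈ rootSpace H χ) (hc : x ∈ center ℂ 𝔤) : x = 0 := by
  rw [mem_genWeightSpace] at hx
  obtain ⟨k, hk⟩ := hx h
  have hpow (k : ℕ) : ((toEnd ℂ H 𝔤 h - χ h • 1) ^ k) x = (-χ h) ^ k • x := by
    induction k with
    | zero => simp
    | succ k ih =>
      have : ⁅(h : 𝔤), x⁆ = 0 := hc h
      rw [pow_succ', Module.End.mul_apply, ih]
      simp [LieSubalgebra.coe_bracket_of_module, this, pow_succ, smul_smul, mul_comm]
  rw [hpow, smul_eq_zero] at hk
  exact hk.resolve_left (pow_ne_zero _ (neg_ne_zero.2 hχ))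

/-- A central element of `H` acts by zero, so a linear form with nonzero weight space vanishes on it
and descends to the quotient. -/
lemma exists_dual_comp_restrictHom (hker : ∀ x, π x = 0 ↔ x ∈ center ℂ 𝔤)
    {χ : Module.Dual ℂ H} (hχ : rootSpace H χ ≠ ⊥) :
    ∃ χ' : Module.Dual ℂ (H.map π), ∀ h, χ' (restrictHom π H h) = χ h := by
  obtain ⟨x, hx, hx0⟩ := (lieSubmodule_ne_bot_iff).1 hχ
  rw [mem_genWeightSpace] at hx
  let p : H →ₗ[ℂ] H.map π := (restrictHom π H : H →ₗ[ℂ] H.map π)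
  have hp : Function.Surjective p := restrictHom_surjective
  have hle : LinearMap.ker p ≤ LinearMap.ker χ := by
    intro h hh
    have hz : (h : 𝔤) ∈ center ℂ 𝔤 := by
      rw [← hker]
      simpa using congrArg Subtype.val (show restrictHom π H h = 0 from hh)
    obtain ⟨k, hk⟩ := hx h
    have h0 : toEnd ℂ H 𝔤 h = 0 := by
      ext y
      change ⁅(h : 𝔤), y⁆ = 0
      rw [← lie_skew, hz y, neg_zero]
    rw [h0, zero_sub, ← neg_smul, smul_pow, one_pow] at hk
    rw [LinearMap.mem_ker]
    simpa [hx0] using (by simpa [hx0] using hk : χ h = 0 ∧ k ≠ 0).1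
  refine ⟨(LinearMap.ker p).liftQ χ hle ∘ₗ (p.quotKerEquivOfSurjective hp).symm, fun h ↦ ?_⟩
  have : (p.quotKerEquivOfSurjective hp).symm (restrictHom π H h) =
      Submodule.Quotient.mk h := by
    rw [LinearEquiv.symm_apply_eq]
    rfl
  simp [this]

variable [(H.map π).IsCartanSubalgebra]

lemma map_mem_rootSpace {χ : H → ℂ} {χ' : H.map π → ℂ} (hχ : ∀ h, χ' (restrictHom π H h) = χ h)
    {x : 𝔤} (hx : x ∈ rootSpace H χ) : π x ∈ rootSpace (H.map π) χ' := by
  rw [mem_genWeightSpace] at hx ⊢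
  intro h'
  obtain ⟨h, rfl⟩ := restrictHom_surjective h'
  obtain ⟨k, hk⟩ := hx h
  refine ⟨k, ?_⟩
  have : (toEnd ℂ (H.map π) Q (restrictHom π H h) - χ' (restrictHom π H h) • 1) ∘ₗ
      (π : 𝔤 →ₗ[ℂ] Q) = (π : 𝔤 →ₗ[ℂ] Q) ∘ₗ (toEnd ℂ H 𝔤 h - χ h • 1) := by
    ext y
    simp [hχ, LieSubalgebra.coe_bracket_of_module]
  simpa [hk] using LinearMap.congr_fun (Module.End.commute_pow_left_of_commute this k) x

lemma IsRoot.exists_weight (hker : ∀ x, π x = 0 ↔ x ∈ center ℂ 𝔤) {α : Module.Dual ℂ H}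
    (hα : IsRoot α) :
    ∃ α' : Weight ℂ (H.map π) Q, α'.IsNonZero ∧ ∀ h, α' (restrictHom π H h) = α h := by
  obtain ⟨α', hα'⟩ := exists_dual_comp_restrictHom (π := π) hker hα.2
  obtain ⟨x, hx, hx0⟩ := (lieSubmodule_ne_bot_iff).1 hα.2
  obtain ⟨h, hh⟩ : ∃ h, α h ≠ 0 := by
    by_contra! h0
    exact hα.1 (LinearMap.ext h0)
  refine ⟨⟨α', (lieSubmodule_ne_bot_iff).2 ⟨π x, map_mem_rootSpace hα' hx, fun h0 ↦
    hx0 (eq_zero_of_mem_rootSpace_of_mem_center hh hx ((hker x).1 h0))⟩⟩, fun h0 ↦ hh ?_, hα'⟩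
  rw [← hα']
  exact congrFun h0 _

variable [FiniteDimensional ℂ 𝔤]

lemma exists_mem_rootSpace_of_map (hπ : Function.Surjective π)
    (hker : ∀ x, π x = 0 ↔ x ∈ center ℂ 𝔤) {χ : H → ℂ} {χ' : H.map π → ℂ}
    (hχ : ∀ h, χ' (restrictHom π H h) = χ h) {y : Q} (hy : y ∈ rootSpace (H.map π) χ') :
    ∃ x ∈ rootSpace H χ, π x = y := by
  -- `N` collects the other weight spaces of the quotient. Splitting a preimage of `y` into weight
  -- components, all those of weight other than `χ` map into `N`, which meets the `χ'`-space
  -- trivially.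
  let N : Submodule ℂ Q := ⨆ (ψ : H.map π → ℂ) (_ : ψ ≠ χ'), (rootSpace (H.map π) ψ).toSubmodule
  have hx (x : 𝔤) : ∃ a ∈ rootSpace H χ, π x - π a ∈ N := by
    have hxt : x ∈ ⨆ ψ : Weight ℂ H 𝔤, genWeightSpace 𝔤 ψ := by
      rw [iSup_genWeightSpace_eq_top']
      trivial
    induction hxt using LieSubmodule.iSup_induction' with
    | mem ψ x hx =>
      by_cases h : (ψ : H → ℂ) = χ
      · exact ⟨x, h ▸ hx, by simp⟩
      · obtain ⟨ψ', hψ'⟩ := exists_dual_comp_restrictHom hker (χ := Weight.toLinear ℂ H 𝔤 ψ)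
          ψ.genWeightSpace_ne_bot
        refine ⟨0, zero_mem _, ?_⟩
        rw [map_zero, sub_zero]
        refine Submodule.mem_iSup_of_mem (ψ' : H.map π → ℂ) (Submodule.mem_iSup_of_mem ?_
          (map_mem_rootSpace hψ' hx))
        rintro rfl
        exact h (funext fun h ↦ by rw [← hχ, hψ']; rfl)
    | zero => exact ⟨0, zero_mem _, by simp⟩
    | add x y _ _ hx hy =>
      obtain ⟨a, ha, ha'⟩ := hx
      obtain ⟨b, hb, hb'⟩ := hy
      refine ⟨a + b, add_mem ha hb, ?_⟩
      convert add_mem ha' hb' using 1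
      simp only [map_add]
      abel
  obtain ⟨x, rfl⟩ := hπ y
  obtain ⟨a, ha, had⟩ := hx x
  refine ⟨a, ha, ?_⟩
  have hdis := (LieSubmodule.iSupIndep_toSubmodule.2
    (iSupIndep_genWeightSpace ℂ (H.map π) Q)) χ'
  have := Submodule.disjoint_def.1 hdis (π x - π a)
    (sub_mem hy (map_mem_rootSpace hχ ha)) had
  exact (sub_eq_zero.1 this).symm

lemma isRoot_of_weight (hπ : Function.Surjective π) (hker : ∀ x, π x = 0 ↔ x ∈ center ℂ 𝔤)
    {α : Module.Dual ℂ H} {α' : Weight ℂ (H.map π) Q} (h0 : α'.IsNonZero)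
    (hα : ∀ h, α' (restrictHom π H h) = α h) : IsRoot α := by
  constructor
  · rintro rfl
    refine h0 (funext fun h' ↦ ?_)
    obtain ⟨h, rfl⟩ := restrictHom_surjective h'
    simp [hα]
  · obtain ⟨y, hy, hy0⟩ := α'.exists_ne_zero
    obtain ⟨x, hx, rfl⟩ := exists_mem_rootSpace_of_map hπ hker hα hy
    exact (lieSubmodule_ne_bot_iff).2 ⟨x, hx, fun h ↦ hy0 (by simp [h])⟩

variable [FiniteDimensional ℂ Q] [IsKilling ℂ Q]

omit [FiniteDimensional ℂ 𝔤] in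
lemma lie_eq_smul_of_mem_rootSpace_aux (hker : ∀ x, π x = 0 ↔ x ∈ center ℂ 𝔤)
    {α : Module.Dual ℂ H} (hα : α ≠ 0) {x : 𝔤} (hx : x ∈ rootSpace H α) (h : H) :
    ⁅(h : 𝔤), x⁆ = α h • x := by
  by_cases hx0 : x = 0
  · simp [hx0]
  obtain ⟨α', hα'⟩ := exists_dual_comp_restrictHom (π := π) hker
    ((lieSubmodule_ne_bot_iff).2 ⟨x, hx, hx0⟩)
  obtain ⟨h₀, hh₀⟩ : ∃ h, α h ≠ 0 := by
    by_contra! h0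
    exact hα (LinearMap.ext h0)
  -- The difference of the two sides is central, by diagonalizability in the quotient, and lies in a
  -- root space for a nonzero root.
  refine sub_eq_zero.1 (eq_zero_of_mem_rootSpace_of_mem_center hh₀ (sub_mem
    (LieSubmodule.lie_mem (rootSpace H α) (x := h) hx) (SMulMemClass.smul_mem _ hx)) ?_)
  rw [← hker, map_sub, map_smul, LieHom.map_lie, sub_eq_zero]
  simpa [hα', LieSubalgebra.coe_bracket_of_module] using
    IsKilling.lie_eq_smul_of_mem_rootSpace (map_mem_rootSpace hα' hx) (restrictHom π H h)

/-- The root space of the quotient is a line, so a multiple of `π x` is the nilpositive element of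
an `sl₂`-triple. Lifting its partner gives `y`; the bracket lies in the zero root space, which is
`H`. -/
lemma exists_lie_map_eq_coroot (hπ : Function.Surjective π)
    (hker : ∀ x, π x = 0 ↔ x ∈ center ℂ 𝔤) {α : Module.Dual ℂ H} {α' : Weight ℂ (H.map π) Q}
    (h0 : α'.IsNonZero) (hα : ∀ h, α' (restrictHom π H h) = α h) {x : 𝔤}
    (hx : x ∈ rootSpace H α) (hx0 : x ≠ 0) :
    ∃ y ∈ rootSpace H (-α), ∃ h : H, ⁅x, y⁆ = h ∧ restrictHom π H h = IsKilling.coroot α' := by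
  obtain ⟨h', e', f', ht, he, hf⟩ := IsKilling.exists_isSl2Triple_of_weight_isNonZero h0
  have hh' := ht.h_eq_coroot h0 he hf
  obtain ⟨k, hk⟩ : ∃ h, α h ≠ 0 := by
    by_contra! h
    exact (isRoot_of_weight hπ hker h0 hα).1 (LinearMap.ext h)
  have hπx : π x ≠ 0 := fun h ↦
    hx0 (eq_zero_of_mem_rootSpace_of_mem_center hk hx ((hker x).1 h))
  obtain ⟨c, hc⟩ : ∃ c : ℂ, c • π x = e' := by
    have h1 := (finrank_eq_one_iff_of_nonzero' (⟨π x, map_mem_rootSpace hα hx⟩ :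
      rootSpace (H.map π) α') (by simpa using hπx)).1 (IsKilling.finrank_rootSpace_eq_one α' h0)
    obtain ⟨c, hc⟩ := h1 ⟨e', he⟩
    exact ⟨c, congrArg Subtype.val hc⟩
  obtain ⟨f, hfα, rfl⟩ := exists_mem_rootSpace_of_map hπ hker (χ := -α) (χ' := -α')
    (fun h ↦ by simp [hα]) hf
  have hmem : ⁅x, c • f⁆ ∈ H := by
    have := lie_mem_genWeightSpace_of_mem_genWeightSpace hx
      (SMulMemClass.smul_mem c hfα : c • f ∈ rootSpace H (-α))
    rwa [add_neg_cancel, show genWeightSpace 𝔤 (0 : H → ℂ) = H.toLieSubmodule from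
      rootSpace_zero_eq ℂ 𝔤 H] at this
  refine ⟨c • f, SMulMemClass.smul_mem c hfα, ⟨_, hmem⟩, rfl, ?_⟩
  ext
  rw [coe_restrictHom, ← hh', ← ht.lie_e_f, ← hc]
  simp

/-- Since `coroot` is an epsilon choice, an element with the defining properties must be exhibited
first. The image of the chosen one then has the properties that characterize the coroot in the
quotient. -/
lemma restrictHom_coroot (hπ : Function.Surjective π)
    (hker : ∀ x, π x = 0 ↔ x ∈ center ℂ 𝔤) {α : Module.Dual ℂ H} {α' : Weight ℂ (H.map π) Q}
    (h0 : α'.IsNonZero) (hα : ∀ h, α' (restrictHom π H h) = α h) :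
    restrictHom π H (coroot α) = IsKilling.coroot α' := by
  obtain ⟨x, hx, hx0⟩ := (lieSubmodule_ne_bot_iff).1 (isRoot_of_weight hπ hker h0 hα).2
  have hex : ∃ h : H, h ∈ corootSpace (⇑α) ∧ α h = 2 := by
    obtain ⟨y, hy, h, hxy, hh⟩ := exists_lie_map_eq_coroot hπ hker h0 hα hx hx0
    refine ⟨h, (mem_corootSpace _).2 (Submodule.subset_span ⟨x, hx, y, hy, hxy⟩), ?_⟩
    rw [← hα, hh, IsKilling.root_apply_coroot h0]
  obtain ⟨h1, h2⟩ : coroot α ∈ corootSpace (⇑α) ∧ α (coroot α) = 2 := Classical.epsilon_spec hex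
  refine IsKilling.eq_coroot_of_mem_corootSpace_of_two α' ?_ (by rw [hα, h2])
  rw [mem_corootSpace] at h1 ⊢
  rw [coe_restrictHom]
  have := Submodule.mem_map_of_mem (f := (π : 𝔤 →ₗ[ℂ] Q)) h1
  rw [Submodule.map_span] at this
  refine Submodule.span_mono ?_ this
  rintro _ ⟨_, ⟨y, hy, z, hz, rfl⟩, rfl⟩
  exact ⟨π y, map_mem_rootSpace hα hy, π z,
    map_mem_rootSpace (χ := -α) (χ' := -α') (fun h ↦ by simp [hα]) hz, by simp⟩

end Quotient

/-! ### Roots and reflections in a reductive Lie algebra -/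

variable (𝔤) in
/-- The projection of a Lie algebra onto the quotient by its centre. -/
def centerProj : 𝔤 →ₗ⁅ℂ⁆ 𝔤 ⧸ center ℂ 𝔤 where
  __ := (LieSubmodule.Quotient.mk' (center ℂ 𝔤) : 𝔤 →ₗ[ℂ] 𝔤 ⧸ center ℂ 𝔤)
  map_lie' := LieSubmodule.Quotient.mk_bracket (I := center ℂ 𝔤) _ _

lemma centerProj_surjective : Function.Surjective (centerProj 𝔤) :=
  LieSubmodule.Quotient.surjective_mk' (center ℂ 𝔤)

lemma centerProj_eq_zero_iff (x : 𝔤) : centerProj 𝔤 x = 0 ↔ x ∈ center ℂ 𝔤 :=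
  LieSubmodule.Quotient.mk_eq_zero (center ℂ 𝔤)

variable [FiniteDimensional ℂ 𝔤] [HasCentralRadical ℂ 𝔤] {H : LieSubalgebra ℂ 𝔤}
  [H.IsCartanSubalgebra]

instance : FiniteDimensional ℂ (𝔤 ⧸ center ℂ 𝔤) :=
  Module.Finite.of_surjective (centerProj 𝔤 : 𝔤 →ₗ[ℂ] _) centerProj_surjective

instance : HasTrivialRadical ℂ (𝔤 ⧸ center ℂ 𝔤) :=
  hasTrivialRadical_of_ker_eq_center centerProj_surjective centerProj_eq_zero_iff

instance : (H.map (centerProj 𝔤)).IsCartanSubalgebra :=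
  isCartanSubalgebra_map centerProj_surjective centerProj_eq_zero_iff

/-- A Cartan subalgebra of a reductive Lie algebra acts diagonalizably. -/
lemma lie_eq_smul_of_mem_rootSpace {α : Module.Dual ℂ H} (hα : α ≠ 0) {x : 𝔤}
    (hx : x ∈ rootSpace H α) (h : H) : ⁅(h : 𝔤), x⁆ = α h • x :=
  lie_eq_smul_of_mem_rootSpace_aux centerProj_eq_zero_iff hα hx h

/-- The bracket `⁅x, y⁆` is compared with the coroot only modulo the centre, which is enough because
roots vanish on the centre. -/
lemma IsRoot.exists_lie_lie_eq_smul {α : Module.Dual ℂ H} (hα : IsRoot α) {x : 𝔤}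
    (hx : x ∈ rootSpace H α) (hx0 : x ≠ 0) :
    ∃ y ∈ rootSpace H (⇑(-α)), ∀ μ : Module.Dual ℂ H, μ ≠ 0 → ∀ z ∈ rootSpace H μ,
      ⁅⁅x, y⁆, z⁆ = μ (coroot α) • z := by
  obtain ⟨α', h0, hα'⟩ := hα.exists_weight centerProj_eq_zero_iff
  obtain ⟨y, hy, h, hxy, hh⟩ := exists_lie_map_eq_coroot centerProj_surjective
    centerProj_eq_zero_iff h0 hα' hx hx0
  refine ⟨y, hy, fun μ hμ0 z hz ↦ ?_⟩
  by_cases hz0 : z = 0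
  · simp [hz0]
  have hμ : IsRoot μ := ⟨hμ0, (lieSubmodule_ne_bot_iff).2 ⟨z, hz, hz0⟩⟩
  obtain ⟨μ', -, hμ'⟩ := hμ.exists_weight centerProj_eq_zero_iff
  rw [hxy, lie_eq_smul_of_mem_rootSpace hμ.1 hz, ← hμ', ← hμ', hh,
    restrictHom_coroot centerProj_surjective centerProj_eq_zero_iff h0 hα']

lemma IsRoot.neg {α : Module.Dual ℂ H} (hα : IsRoot α) : IsRoot (-α) := by
  obtain ⟨α', h0, hα'⟩ := hα.exists_weight centerProj_eq_zero_iff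
  exact isRoot_of_weight centerProj_surjective centerProj_eq_zero_iff h0.neg
    fun h ↦ by simp [hα']

lemma IsRoot.apply_coroot_neg {α μ : Module.Dual ℂ H} (hα : IsRoot α) (hμ : IsRoot μ) :
    μ (coroot (-α)) = -μ (coroot α) := by
  obtain ⟨α', h0, hα'⟩ := hα.exists_weight centerProj_eq_zero_iff
  obtain ⟨μ', -, hμ'⟩ := hμ.exists_weight centerProj_eq_zero_iff
  rw [← hμ', ← hμ', restrictHom_coroot centerProj_surjective centerProj_eq_zero_iff h0 hα',
    restrictHom_coroot (α' := -α') centerProj_surjective centerProj_eq_zero_iff h0.neg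
      (fun h ↦ by simp [hα']), IsKilling.coroot_neg, ← Weight.toLinear_apply, map_neg]
  rfl

lemma IsRoot.apply_coroot_self {α : Module.Dual ℂ H} (hα : IsRoot α) : α (coroot α) = 2 := by
  obtain ⟨α', h0, hα'⟩ := hα.exists_weight centerProj_eq_zero_iff
  rw [← hα', restrictHom_coroot centerProj_surjective centerProj_eq_zero_iff h0 hα',
    IsKilling.root_apply_coroot h0]

lemma IsRoot.reflect {α μ : Module.Dual ℂ H} (hα : IsRoot α) (hμ : IsRoot μ) :
    IsRoot (μ - μ (coroot α) • α) := by
  obtain ⟨α', h0, hα'⟩ := hα.exists_weight centerProj_eq_zero_iff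
  obtain ⟨μ', h1, hμ'⟩ := hμ.exists_weight centerProj_eq_zero_iff
  refine isRoot_of_weight centerProj_surjective centerProj_eq_zero_iff
    (IsKilling.reflectRoot_isNonZero α' μ' h1) fun h ↦ ?_
  change μ' _ - μ' (IsKilling.coroot α') * α' _ = _
  rw [← restrictHom_coroot centerProj_surjective centerProj_eq_zero_iff h0 hα', hμ', hμ', hα']
  simp

end

section

/-! ### Roots in coordinates -/

/-- The simple reflection `s_k` in the coordinates of the simple roots, for the Cartan
matrix `A`. -/
def simpleReflection {m : ℕ} (A : Matrix (Fin m) (Fin m) ℤ) (k : Fin m) (v : Fin m → ℤ) :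
    Fin m → ℤ :=
  v - Pi.single k (A.mulVec v k)

/-- At most `n` simple reflections take `v` to a vector with coefficients of both signs. -/
def ReflectsToMixed {m : ℕ} (A : Matrix (Fin m) (Fin m) ℤ) : ℕ → (Fin m → ℤ) → Prop
  | 0, v => (∃ k, 0 < v k) ∧ ∃ k, v k < 0
  | n + 1, v => ReflectsToMixed A n v ∨ ∃ k, ReflectsToMixed A n (simpleReflection A k v)

instance {m : ℕ} (A : Matrix (Fin m) (Fin m) ℤ) (n : ℕ) (v : Fin m → ℤ) :
    Decidable (ReflectsToMixed A n v) := by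
  induction n generalizing v with
  | zero => unfold ReflectsToMixed; infer_instance
  | succ n ih => unfold ReflectsToMixed; infer_instance

/-- Adding or subtracting the `k`-th simple root. -/
def shift {m : ℕ} (s : Fin m → Bool) (v : Fin m → ℤ) (k : Fin m) : Fin m → ℤ :=
  v + Pi.single k (if s k then -1 else 1)

/-- A combinatorial certificate for the following fact: a root vector of weight `-v` is a bracket
`⁅u, e⁆`, where `e` is the sum of the root vectors of the signed simple roots other than the one at
the vertex `b`, and where `u` commutes with the root vector at `b`. The signs are given by `s`. -/
def Killable {m : ℕ} (A : Matrix (Fin m) (Fin m) ℤ) (s : Fin m → Bool) (b : Fin m) :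
    ℕ → (Fin m → ℤ) → Prop
  | 0, v => ReflectsToMixed A 3 v
  | n + 1, v => ReflectsToMixed A 3 v ∨
      ∃ p, s p = true ∧ v p = 0 ∧ A.mulVec v p ≠ 0 ∧
        ReflectsToMixed A 3 (v + Pi.single p 1 + Pi.single b 1) ∧
        ∀ k, k ≠ p → k ≠ b → Killable A s b n (shift s (v + Pi.single p 1) k)

instance {m : ℕ} (A : Matrix (Fin m) (Fin m) ℤ) (s : Fin m → Bool) (b : Fin m) (n : ℕ)
    (v : Fin m → ℤ) : Decidable (Killable A s b n v) := by
  induction n generalizing v with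
  | zero => unfold Killable; infer_instance
  | succ n ih => unfold Killable; infer_instance

variable {𝔤 : Type*} [LieRing 𝔤] [LieAlgebra ℂ 𝔤] [FiniteDimensional ℂ 𝔤]
  {H : LieSubalgebra ℂ 𝔤} [H.IsCartanSubalgebra] {I : Type*} [Fintype I]
  {Δ : I → Module.Dual ℂ H}

lemma lie_mem_rootSpace {μ ν : Module.Dual ℂ H} {x y : 𝔤} (hx : x ∈ rootSpace H μ)
    (hy : y ∈ rootSpace H ν) : ⁅x, y⁆ ∈ rootSpace H (⇑(μ + ν)) :=
  lie_mem_genWeightSpace_of_mem_genWeightSpace hx hy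

lemma eq_zero_of_not_isRoot {μ : Module.Dual ℂ H} (hμ : ¬ IsRoot μ) {h : H} (h0 : μ h ≠ 0) {x : 𝔤}
    (hx : x ∈ rootSpace H μ) : x = 0 := by
  by_contra hx0
  exact hμ ⟨fun h ↦ h0 (by simp [h]), lieSubmodule_ne_bot_iff.2 ⟨x, hx, hx0⟩⟩

/-- These dual elements read off the coefficients of a weight in the simple roots. -/
lemma exists_coweight [DecidableEq I] (hΔ : LinearIndependent ℂ Δ) :
    ∃ t : I → H, ∀ i j, Δ i (t j) = if i = j then 1 else 0 := by
  have hex (j : I) : ∃ t : H, ∀ i, Δ i t = if i = j then 1 else 0 := by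
    obtain ⟨F, hF⟩ : ∃ F : Module.Dual ℂ (Module.Dual ℂ H), ∀ i, F (Δ i) = if i = j then 1 else 0 := by
      obtain ⟨F, hF⟩ := LinearMap.exists_extend
        (((Module.Basis.span hΔ).constr ℂ (fun i ↦ if i = j then (1 : ℂ) else 0)))
      refine ⟨F, fun i ↦ ?_⟩
      have h1 := LinearMap.congr_fun hF (Module.Basis.span hΔ i)
      rw [Module.Basis.constr_basis] at h1
      simpa [Module.Basis.span_apply] using h1
    refine ⟨(Module.evalEquiv ℂ H).symm F, fun i ↦ ?_⟩
    rw [← hF, Module.apply_evalEquiv_symm_apply]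
  choose t ht using hex
  exact ⟨t, fun i j ↦ ht j i⟩

lemma IsSimpleSystem.not_isRoot [DecidableEq I] (hΔ : IsSimpleSystem Δ) {t : I → H}
    (ht : ∀ i j, Δ i (t j) = if i = j then 1 else 0) {μ : Module.Dual ℂ H} {i j : I} {a b : ℤ}
    (hi : μ (t i) = a) (ha : 0 < a) (hj : μ (t j) = b) (hb : b < 0) : ¬ IsRoot μ := by
  intro hμ
  obtain ⟨n, rfl | rfl⟩ := hΔ.pos_or_neg μ hμ
  · have : (n j : ℂ) = b := by simpa [ht] using hj
    have : (n j : ℤ) = b := by exact_mod_cast this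
    lia
  · have : -(n i : ℂ) = a := by simpa [ht] using hi
    have : -(n i : ℤ) = a := by exact_mod_cast this
    lia

/-- The weight with coordinates `v` with respect to the simple roots at the vertices `f`. -/
def weightOf (Δ : I → Module.Dual ℂ H) {m : ℕ} (f : Fin m → I) (v : Fin m → ℤ) :
    Module.Dual ℂ H :=
  ∑ k, (v k : ℂ) • Δ (f k)

variable {m : ℕ} {f : Fin m → I} {A : Matrix (Fin m) (Fin m) ℤ}

lemma weightOf_add (v w : Fin m → ℤ) : weightOf Δ f (v + w) = weightOf Δ f v + weightOf Δ f w := by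
  simp [weightOf, add_smul, Finset.sum_add_distrib]

lemma weightOf_single (k : Fin m) (c : ℤ) : weightOf Δ f (Pi.single k c) = (c : ℂ) • Δ (f k) := by
  rw [weightOf, Finset.sum_eq_single k] <;> simp +contextual

lemma weightOf_apply_coweight [DecidableEq I] (hf : Function.Injective f) {t : I → H}
    (ht : ∀ i j, Δ i (t j) = if i = j then 1 else 0) (v : Fin m → ℤ) (k : Fin m) :
    weightOf Δ f v (t (f k)) = v k := by
  simp [weightOf, ht, hf.eq_iff]

lemma weightOf_apply_coweight_of_notMem [DecidableEq I] {t : I → H}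
    (ht : ∀ i j, Δ i (t j) = if i = j then 1 else 0) (v : Fin m → ℤ) {i : I}
    (hi : i ∉ Set.range f) : weightOf Δ f v (t i) = 0 := by
  have (k : Fin m) : f k ≠ i := fun h ↦ hi ⟨k, h⟩
  simp [weightOf, ht, this]

lemma weightOf_apply_coroot (hA : FormsDiagram Δ f A) (v : Fin m → ℤ) (k : Fin m) :
    weightOf Δ f v (coroot (Δ (f k))) = (A.mulVec v k : ℤ) := by
  simp only [weightOf, LinearMap.sum_apply, LinearMap.smul_apply, smul_eq_mul, Matrix.mulVec,
    dotProduct, Int.cast_sum, Int.cast_mul]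
  exact Finset.sum_congr rfl fun l _ ↦ by rw [← hA.2 k l, cartanInt, mul_comm]

variable [HasCentralRadical ℂ 𝔤]

/-- Simple reflections preserve roots, and no root has coefficients of both signs. The bound on
their number makes this criterion decidable. -/
lemma ReflectsToMixed.not_isRoot [DecidableEq I] (hΔ : IsSimpleSystem Δ) {t : I → H}
    (ht : ∀ i j, Δ i (t j) = if i = j then 1 else 0) (hA : FormsDiagram Δ f A) {n : ℕ}
    {v : Fin m → ℤ} (hv : ReflectsToMixed A n v) : ¬ IsRoot (weightOf Δ f v) := by
  induction n generalizing v with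
  | zero =>
    obtain ⟨⟨k, hk⟩, l, hl⟩ := hv
    exact hΔ.not_isRoot ht (weightOf_apply_coweight hA.1 ht v k) hk
      (weightOf_apply_coweight hA.1 ht v l) hl
  | succ n ih =>
    obtain hv | ⟨k, hv⟩ := hv
    · exact ih hv
    · intro hr
      refine ih hv ?_
      have := (hΔ.isRoot (f k)).reflect hr
      rwa [weightOf_apply_coroot hA, sub_eq_add_neg, ← neg_smul, ← Int.cast_neg,
        ← weightOf_single, ← weightOf_add, Pi.single_neg, ← sub_eq_add_neg] at this

/-! ### Killing one summand -/

/-- The sign of a vertex, `1` on `P` and `-1` elsewhere. -/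
def signOf (P : Finset I) (i : I) : ℂ :=
  open Classical in if i ∈ P then 1 else -1

lemma signedSum_eq_sum [DecidableEq I] (X : Module.Dual ℂ H → 𝔤) {P N : Finset I}
    (h : Disjoint P N) : signedSum X Δ P N = ∑ i ∈ P ∪ N, X (signOf P i • Δ i) := by
  rw [signedSum, Finset.sum_union h]
  congr 1
  · exact Finset.sum_congr rfl fun i hi ↦ by simp [signOf, hi]
  · exact Finset.sum_congr rfl fun i hi ↦ by
      simp [signOf, Finset.disjoint_right.1 h hi]

end

/-! ### Solving for the exponent from a certificate -/

section

variable {𝔤 : Type*} [LieRing 𝔤] [LieAlgebra ℂ 𝔤] [FiniteDimensional ℂ 𝔤]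
  [HasCentralRadical ℂ 𝔤] {H : LieSubalgebra ℂ 𝔤} [H.IsCartanSubalgebra] {I : Type*} [Fintype I]
  [DecidableEq I] {Δ : I → Module.Dual ℂ H} {X : Module.Dual ℂ H → 𝔤}

omit [FiniteDimensional ℂ 𝔤] [HasCentralRadical ℂ 𝔤] in
lemma smul_mem_rootSpace {χ : H → ℂ} {x : 𝔤} (c : ℂ) (hx : x ∈ rootSpace H χ) :
    c • x ∈ rootSpace H χ :=
  (rootSpace H χ).smul_mem c hx

/-- As `w` commutes with `x`, the Jacobi identity gives `⁅⁅w, y⁆, x⁆ = ⁅⁅x, y⁆, w⁆`, a nonzero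
multiple of `w`; so `⁅w, y⁆` need only be rescaled. -/
lemma IsRoot.exists_lie_eq {α μ : Module.Dual ℂ H} (hα : IsRoot α) (hμ : μ ≠ 0)
    (h0 : μ (coroot α) ≠ 0) {x w : 𝔤} (hx : x ∈ rootSpace H α) (hx0 : x ≠ 0)
    (hw : w ∈ rootSpace H μ) (hwx : ⁅w, x⁆ = 0) :
    ∃ u ∈ rootSpace H (⇑(μ + -α)), ⁅u, x⁆ = w := by
  obtain ⟨y, hy, hyz⟩ := hα.exists_lie_lie_eq_smul hx hx0
  have h1 : ⁅⁅w, y⁆, x⁆ = ⁅⁅x, y⁆, w⁆ := by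
    rw [lie_lie w, hwx, lie_zero, sub_zero, ← lie_skew, ← lie_skew y, neg_lie, neg_neg]
  refine ⟨(μ (coroot α))⁻¹ • ⁅w, y⁆, smul_mem_rootSpace _ (lie_mem_rootSpace hw hy), ?_⟩
  rw [smul_lie, h1, hyz μ hμ w hw, smul_smul, inv_mul_cancel₀ h0, one_smul]

lemma isRoot_signOf_smul (hΔ : IsSimpleSystem Δ) (P : Finset I) (i : I) :
    IsRoot (signOf P i • Δ i) := by
  unfold signOf
  split_ifs
  · simpa using hΔ.isRoot i
  · simpa using (hΔ.isRoot i).neg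

variable {m : ℕ} {f : Fin m → I} {A : Matrix (Fin m) (Fin m) ℤ} {s : Fin m → Bool} {b : Fin m}

/-- A vector of weight `-v`, where `v` is supported on a subdiagram, commutes with the root vectors
of the signed simple roots outside it. -/
lemma lie_eq_zero_of_notMem_range (hΔ : IsSimpleSystem Δ) {t : I → H}
    (ht : ∀ i j, Δ i (t j) = if i = j then 1 else 0) (hA : FormsDiagram Δ f A) {P : Finset I}
    (nbr : NeighboursIn Δ f P) {v : Fin m → ℤ} (hvb : v b = 1) {x y : 𝔤}
    (hx : x ∈ rootSpace H (⇑(-weightOf Δ f v))) {i : I} (hi : i ∉ Set.range f)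
    (hy : y ∈ rootSpace H (⇑(signOf P i • Δ i))) : ⁅x, y⁆ = 0 := by
  have hb : weightOf Δ f v (t (f b)) = (1 : ℤ) := by rw [weightOf_apply_coweight hA.1 ht, hvb]
  have hwi := weightOf_apply_coweight_of_notMem ht v hi
  have hib : i ≠ f b := fun h ↦ hi ⟨b, h.symm⟩
  refine eq_zero_of_not_isRoot (h := t (f b)) ?_ ?_ (lie_mem_rootSpace hx hy)
  -- For `i ∈ P` the weight has coefficient 1 at `i` and -1 at `b`. Otherwise `i` is orthogonal to
  -- the subdiagram, and the reflection at `i` turns its coefficient -1 into 1.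
  · by_cases hP : i ∈ P
    · refine hΔ.not_isRoot ht (i := i) (j := f b) (a := 1) (b := -1) ?_ one_pos ?_ (by simp)
      · simp [signOf, hP, hwi, ht]
      · simp [signOf, hP, hb, ht, hib]
    · intro hr
      have h0 : weightOf Δ f v (coroot (Δ i)) = 0 := by
        refine (LinearMap.sum_apply _ _ _).trans (Finset.sum_eq_zero fun k _ ↦ ?_)
        by_cases hk : cartanInt Δ i (f k) = 0
        · rw [cartanInt] at hk
          simp [hk]
        · exact absurd (nbr i hi ⟨k, fun h ↦ hi ⟨k, h.symm⟩, hk⟩) hP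
      refine hΔ.not_isRoot ht (i := i) (j := f b) (a := 1) (b := -1) ?_ one_pos ?_ (by simp)
        ((hΔ.isRoot i).reflect hr)
      · simp [signOf, hP, hwi, ht, h0, (hΔ.isRoot i).apply_coroot_self]
        norm_num
      · simp [signOf, hP, hb, ht, hib]
  · simp [hb, ht, hib]

/-- Induction along the certificate. Either `-v` is not a root and `w = 0`, or `w = ⁅u', X (Δ (f
p))⁆` for some positive vertex `p`. The brackets of `u'` with the other summands have weights
covered by the sub-certificates and are cancelled by induction. The eigenvalue -1 of the coweight at
`b` is carried along for nilpotency. -/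
lemma Killable.exists_lie_eq (hΔ : IsSimpleSystem Δ) (hX : IsRootVectors X) {t : I → H}
    (ht : ∀ i j, Δ i (t j) = if i = j then 1 else 0) (hA : FormsDiagram Δ f A) {P S : Finset I}
    (nbr : NeighboursIn Δ f P) (hs : ∀ k, signOf P (f k) = if s k then 1 else -1)
    (hS : ∀ k, f k ∈ S ↔ k ≠ b) (hsb : s b = false) {n : ℕ} {v : Fin m → ℤ}
    (hv : Killable A s b n v) (hvb : v b = 1) {w : 𝔤}
    (hw : w ∈ rootSpace H (⇑(-weightOf Δ f v))) :
    ∃ u : 𝔤, ⁅(t (f b) : 𝔤), u⁆ = (-1 : ℂ) • u ∧ ⁅u, ∑ i ∈ S, X (signOf P i • Δ i)⁆ = w ∧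
      ⁅u, X (-Δ (f b))⁆ = 0 := by
  have hroot {v : Fin m → ℤ} (hvb : v b = 1) (hv : ReflectsToMixed A 3 v) {w : 𝔤}
      (hw : w ∈ rootSpace H (⇑(-weightOf Δ f v))) : w = 0 := by
    refine eq_zero_of_not_isRoot (h := t (f b)) (fun h ↦ ?_) ?_ hw
    · exact hv.not_isRoot hΔ ht hA (by simpa using h.neg)
    · simp [weightOf_apply_coweight hA.1 ht, hvb]
  have hzero {v : Fin m → ℤ} (hvb : v b = 1) (hv : ReflectsToMixed A 3 v) {w : 𝔤}
      (hw : w ∈ rootSpace H (⇑(-weightOf Δ f v))) : ∃ u : 𝔤, ⁅(t (f b) : 𝔤), u⁆ = (-1 : ℂ) • u ∧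
      ⁅u, ∑ i ∈ S, X (signOf P i • Δ i)⁆ = w ∧ ⁅u, X (-Δ (f b))⁆ = 0 :=
    ⟨0, by simp, by simp [hroot hvb hv hw], by simp⟩
  have hXr (i : I) := hX _ (isRoot_signOf_smul hΔ P i)
  induction n generalizing v w with
  | zero => exact hzero hvb hv hw
  | succ n ih =>
    obtain hv | ⟨p, hsp, hvp, hAp, hpb, hk⟩ := hv
    · exact hzero hvb hv hw
    have hpb' : p ≠ b := by
      rintro rfl
      simp [hsb] at hsp
    have hP : signOf P (f p) • Δ (f p) = Δ (f p) := by simp [hs, hsp]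
    obtain ⟨hXp, hXp0⟩ := hXr (f p)
    rw [hP] at hXp hXp0
    have hwb : weightOf Δ f v (t (f b)) = 1 := by rw [weightOf_apply_coweight hA.1 ht, hvb]; simp
    have hw0 : -weightOf Δ f v ≠ 0 := fun h ↦ by
      have := LinearMap.congr_fun h (t (f b))
      simp [hwb] at this
    -- Because `v p = 0` and `v b = 1`, the weight of this bracket has mixed signs.
    have hwX : ⁅w, X (Δ (f p))⁆ = 0 := by
      refine eq_zero_of_not_isRoot (h := t (f b)) ?_ ?_ (lie_mem_rootSpace hw hXp)
      · refine hΔ.not_isRoot ht (i := f p) (j := f b) (a := 1) (b := -1) ?_ one_pos ?_ (by simp)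
        · simp [weightOf_apply_coweight hA.1 ht, hvp, ht]
        · simp [hwb, ht, hA.1.eq_iff, hpb']
      · simp [hwb, ht, hA.1.eq_iff, hpb']
    obtain ⟨u', hu'mem, hu'p⟩ := (hΔ.isRoot (f p)).exists_lie_eq hw0
      (by rw [LinearMap.neg_apply, weightOf_apply_coroot hA]; exact_mod_cast neg_ne_zero.2 hAp)
      hXp hXp0 hw hwX
    obtain ⟨v', hv'⟩ : ∃ v', v' = v + Pi.single p 1 := ⟨_, rfl⟩
    rw [← neg_add, show weightOf Δ f v + Δ (f p) = weightOf Δ f v' by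
      rw [hv', weightOf_add, weightOf_single, Int.cast_one, one_smul]] at hu'mem
    rw [← hv'] at hpb hk
    have hv'b : v' b = 1 := by simp [hv', hvb, hpb'.symm]
    have hu'b : ⁅u', X (-Δ (f b))⁆ = 0 := by
      have h1 := (hX _ (hΔ.isRoot (f b)).neg).1
      have h2 := lie_mem_rootSpace hu'mem h1
      rw [← neg_add] at h2
      refine eq_zero_of_not_isRoot (h := t (f b)) (fun h ↦ ?_) ?_ h2
      · refine hpb.not_isRoot hΔ ht hA ?_
        rw [weightOf_add, weightOf_single, Int.cast_one, one_smul]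
        simpa using h.neg
      · simp [weightOf_apply_coweight hA.1 ht, ht, hv'b]
    have hex (k : Fin m) : ∃ u : 𝔤, k ≠ p → k ≠ b → ⁅(t (f b) : 𝔤), u⁆ = (-1 : ℂ) • u ∧
        ⁅u, ∑ i ∈ S, X (signOf P i • Δ i)⁆ = ⁅u', X (signOf P (f k) • Δ (f k))⁆ ∧
        ⁅u, X (-Δ (f b))⁆ = 0 := by
      by_cases hkp : k = p
      · exact ⟨0, fun h ↦ absurd hkp h⟩
      by_cases hkb : k = b
      · exact ⟨0, fun _ h ↦ absurd hkb h⟩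
      obtain ⟨u, hu⟩ := ih (hk k hkp hkb) (by simp [shift, hv'b, Ne.symm hkb])
        (w := ⁅u', X (signOf P (f k) • Δ (f k))⁆) (by
          have := lie_mem_rootSpace hu'mem (hXr (f k)).1
          convert this using 2
          rw [shift, weightOf_add, weightOf_single, hs, neg_add]
          split_ifs <;> simp)
      exact ⟨u, fun _ _ ↦ hu⟩
    choose U hU using hex
    set K : Finset (Fin m) := (Finset.univ.erase b).erase p with hK
    have hUK {k : Fin m} (hkK : k ∈ K) := hU k (by simp_all) (by simp_all)
    have hsum : ⁅u', ∑ i ∈ S, X (signOf P i • Δ i)⁆ =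
        w + ∑ k ∈ K, ⁅u', X (signOf P (f k) • Δ (f k))⁆ := by
      have himg : (Finset.univ.erase b).image f ⊆ S := by
        intro i hi
        obtain ⟨k, hk, rfl⟩ := Finset.mem_image.1 hi
        exact (hS k).2 (Finset.ne_of_mem_erase hk)
      rw [lie_sum, ← Finset.sum_subset himg fun i hi hni ↦ ?_, Finset.sum_image hA.1.injOn,
        ← Finset.add_sum_erase _ _ (Finset.mem_erase.2 ⟨hpb', Finset.mem_univ p⟩), hP, hu'p]
      refine lie_eq_zero_of_notMem_range hΔ ht hA nbr hv'b hu'mem ?_ (hXr i).1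
      rintro ⟨k, rfl⟩
      exact hni (Finset.mem_image_of_mem f (by simpa using (hS k).1 hi))
    -- `U k` reproduces the unwanted term `⁅u', X (signOf P (f k) • Δ (f k))⁆`, so subtracting these
    -- corrections leaves exactly `w`.
    refine ⟨u' - ∑ k ∈ K, U k, ?_, ?_, ?_⟩
    · have h1 : ⁅(t (f b) : 𝔤), u'⁆ = (-1 : ℂ) • u' := by
        rw [lie_eq_smul_of_mem_rootSpace (fun h ↦ ?_) hu'mem (t (f b)), LinearMap.neg_apply,
          weightOf_apply_coweight hA.1 ht, hv'b, Int.cast_one]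
        have := LinearMap.congr_fun h (t (f b))
        simp [weightOf_apply_coweight hA.1 ht, hv'b] at this
      rw [lie_sub, lie_sum, h1, smul_sub, Finset.smul_sum]
      congr 1
      exact Finset.sum_congr rfl fun k hk ↦ (hUK hk).1
    · rw [sub_lie, sum_lie, hsum, add_sub_assoc, ← Finset.sum_sub_distrib,
        Finset.sum_eq_zero fun k hk ↦ sub_eq_zero.2 (hUK hk).2.1.symm, add_zero]
    · rw [sub_lie, sum_lie, hu'b, Finset.sum_eq_zero fun k hk ↦ (hUK hk).2.2, sub_zero]

section Signs

omit [FiniteDimensional ℂ 𝔤] [HasCentralRadical ℂ 𝔤] [H.IsCartanSubalgebra] [Fintype I]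

variable {P N : Finset I}

omit [DecidableEq I] in
lemma signOf_eq (hPN : Disjoint P N) (hs : ∀ k, if s k then f k ∈ P else f k ∈ N) (k : Fin m) :
    signOf P (f k) = if s k then 1 else -1 := by
  have := hs k
  unfold signOf
  cases h : s k <;> rw [h] at this
  · simp [Finset.disjoint_right.1 hPN (by simpa using this)]
  · simp [show f k ∈ P by simpa using this]

lemma mem_union_sdiff_iff (hPN : Disjoint P N) (hf : Function.Injective f)
    (hs : ∀ k, if s k then f k ∈ P else f k ∈ N) (hb : f b ∈ N) (k : Fin m) :
    f k ∈ P ∪ (N \ {f b}) ↔ k ≠ b := by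
  constructor
  · rintro h rfl
    simp [Finset.disjoint_right.1 hPN hb] at h
  · intro h
    have := hs k
    split_ifs at this <;> simp [this, hf.eq_iff, h]

lemma signedSum_eq_add {i : I} (hi : i ∈ N) :
    signedSum X Δ P N = signedSum X Δ P (N \ {i}) + X (-Δ i) := by
  rw [signedSum, signedSum, add_assoc, Finset.sdiff_singleton_eq_erase, add_comm _ (X _),
    Finset.add_sum_erase _ (fun i ↦ X (-Δ i)) hi]

end Signs

/-- The signed vertex `b` can be removed by a single exponential when there is a combinatorial
certificate for it. -/
theorem Killable.areConjugate (hΔ : IsSimpleSystem Δ) (hX : IsRootVectors X)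
    {P N : Finset I} (hPN : Disjoint P N) (hA : FormsDiagram Δ f A) (nbr : NeighboursIn Δ f P)
    (hs : ∀ k, if s k then f k ∈ P else f k ∈ N) (hsb : s b = false) {n : ℕ}
    (hv : Killable A s b n (Pi.single b 1)) :
    AreConjugate (signedSum X Δ P N) (signedSum X Δ P (N \ {f b})) := by
  obtain ⟨t, ht⟩ := exists_coweight hΔ.linearIndependent
  have hbN : f b ∈ N := by simpa [hsb] using hs b
  have hdec := signedSum_eq_add (Δ := Δ) (X := X) (P := P) hbN
  obtain ⟨u, hu, hue, hub⟩ := hv.exists_lie_eq hΔ hX ht hA nbr (signOf_eq hPN hs)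
    (mem_union_sdiff_iff hPN hA.1 hs hbN) hsb (by simp) (w := -X (-Δ (f b))) (by
      rw [weightOf_single, Int.cast_one, one_smul]
      exact neg_mem (hX _ (hΔ.isRoot _).neg).1)
  rw [← signedSum_eq_sum X (hPN.mono_right Finset.sdiff_subset)] at hue
  have := areConjugate_sub (x := signedSum X Δ P N) (neg_ne_zero.2 one_ne_zero) hu
    (by rw [hdec, lie_add, hub, hue, add_zero]) hub
  rwa [hdec, add_sub_cancel_right, ← hdec] at this

end

/-! ### Removing a summand by means of an `sl₂`-triple -/

section

variable {𝔤 : Type*} [LieRing 𝔤] [LieAlgebra ℂ 𝔤] [FiniteDimensional ℂ 𝔤]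

lemma exists_eigenspace_neg_eq_bot {V : Type*} [AddCommGroup V] [Module ℂ V]
    [FiniteDimensional ℂ V] (T : Module.End ℂ V) :
    ∃ K : ℕ, ∀ j : ℕ, K ≤ j → T.eigenspace (-(j : ℂ)) = ⊥ := by
  have hfin : {j : ℕ | T.HasEigenvalue (-(j : ℂ))}.Finite :=
    T.finite_hasEigenvalue.preimage (f := fun j : ℕ ↦ (-(j : ℂ)))
      (Function.Injective.injOn fun a b h ↦ by simpa using h)
  obtain ⟨K, hK⟩ := hfin.bddAbove
  refine ⟨K + 1, fun j hj ↦ ?_⟩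
  by_contra h
  have := hK (show j ∈ {j : ℕ | T.HasEigenvalue (-(j : ℂ))} from h)
  lia

/-- Let `(h, e, f)` be an `sl₂`-triple and let `t` commute with it. Adding to `e` an eigenvector of
`t` and `h` with eigenvalues `-1` and `3` does not change the orbit of `e`. -/
theorem areConjugate_add_of_isSl2Triple {h e f t x : 𝔤} (hef : IsSl2Triple h e f)
    (hte : ⁅t, e⁆ = 0) (htf : ⁅t, f⁆ = 0) (htx : ⁅t, x⁆ = (-1 : ℂ) • x)
    (hhx : ⁅h, x⁆ = (3 : ℂ) • x) : AreConjugate (e + x) e := by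
  -- The weights are tied together so that solving `⁅e, u⁆ = g` for `g ∈ G k` gives `u` of weights
  -- `-k` and `k`, and `ad u` then maps `G j` into `G (j + k)`.
  let G (k : ℕ) : Submodule ℂ 𝔤 :=
    (ad ℂ 𝔤 t).eigenspace (-(k : ℂ)) ⊓ (ad ℂ 𝔤 h).eigenspace (k + 2 : ℂ)
  have mem_G {k : ℕ} {y : 𝔤} : y ∈ G k ↔ ⁅t, y⁆ = (-(k : ℂ)) • y ∧ ⁅h, y⁆ = (k + 2 : ℂ) • y := by
    simp [G]
  let R (k : ℕ) : Submodule ℂ 𝔤 := ⨆ (j : ℕ) (_ : k ≤ j), G j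
  have G_le {j k : ℕ} (hjk : k ≤ j) : G j ≤ R k := le_iSup₂_of_le j hjk le_rfl
  have R_anti {j k : ℕ} (hjk : k ≤ j) : R j ≤ R k :=
    iSup₂_le fun i hi ↦ G_le (hjk.trans hi)
  have R_succ (k : ℕ) : R k ≤ G k ⊔ R (k + 1) := by
    refine iSup₂_le fun j hj ↦ ?_
    obtain rfl | hlt := hj.eq_or_lt
    · exact le_sup_left
    · exact (G_le hlt).trans le_sup_right
  obtain ⟨K, hK⟩ := exists_eigenspace_neg_eq_bot (ad ℂ 𝔤 t)
  have R_K : R K = ⊥ := by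
    rw [eq_bot_iff]
    exact iSup₂_le fun j hj ↦ inf_le_left.trans (hK j hj).le
  -- `d` bounds the number of layers left before `R K = ⊥`. The condition `1 ≤ k` makes `u`
  -- nilpotent and every step a strict gain.
  have main (d : ℕ) : ∀ k, 1 ≤ k → K ≤ k + d → ∀ r ∈ R k, AreConjugate (e + r) e := by
    induction d with
    | zero =>
      intro k _ hk r hr
      have : r = 0 := by simpa [R_K] using R_anti hk hr
      rw [this, add_zero]
      exact areConjugate_refl e
    | succ d ih =>
      intro k hk1 hk r hr
      obtain ⟨g, hg, r', hr', rfl⟩ := Submodule.mem_sup.1 (R_succ k hr)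
      obtain ⟨hg1, hg2⟩ := mem_G.1 hg
      obtain ⟨u, hu, htu, heu⟩ := hef.exists_lie_e_eq hte htf (m := k + 2) (by lia)
        (by simpa using hg2) hg1
      have hk0 : (-(k : ℂ)) ≠ 0 := neg_ne_zero.2 (by exact_mod_cast (by lia : k ≠ 0))
      have hnil := isNilpotent_ad_of_lie_eq_smul hk0 htu
      have hR {j : ℕ} : ∀ y ∈ R j, ad ℂ 𝔤 u y ∈ R (j + 1) := by
        have : R j ≤ (R (j + 1)).comap (ad ℂ 𝔤 u) := by
          refine iSup₂_le fun i hi y hy ↦ G_le (j := k + i) (by lia) (mem_G.2 ?_)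
          obtain ⟨h1, h2⟩ := mem_G.1 hy
          rw [ad_apply]
          constructor
          · rw [leibniz_lie, htu, h1, smul_lie, lie_smul, ← add_smul]
            push_cast
            ring_nf
          · rw [leibniz_lie, hu, h2, smul_lie, lie_smul, ← add_smul]
            push_cast
            ring_nf
        exact this
      have hDg := hR _ (G_le le_rfl hg)
      -- The first-order term cancels the leading part `g`; everything else lands in `R (k + 1)`.
      have hDx : ad ℂ 𝔤 u (e + (g + r')) = -g + ad ℂ 𝔤 u (g + r') := by
        rw [map_add, ad_apply, ← lie_skew, heu]
      have hW : ∀ w ∈ R (k + 1), ad ℂ 𝔤 u w ∈ R (k + 1) := fun w hw ↦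
        R_anti (Nat.le_succ _) (hR w hw)
      have hstep := nilExp_apply_sub_mem hnil hW (x := e + (g + r')) (by
        rw [hDx, map_add, map_neg]
        exact add_mem (neg_mem hDg) (hW _ (hR _ hr)))
      refine (areConjugate_nilExp hnil _).trans ?_
      obtain ⟨z, hz⟩ : ∃ z, z = nilExp (ad ℂ 𝔤 u) (e + (g + r')) := ⟨_, rfl⟩
      rw [← hz] at hstep ⊢
      have hz' : z - e ∈ R (k + 1) := by
        have := add_mem hstep (add_mem hr' (hR _ hr))
        rw [hDx] at this
        convert this using 1
        abel
      simpa using ih (k + 1) (by lia) (by lia) _ hz'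
  exact main K 1 le_rfl (by lia) x (G_le le_rfl (mem_G.2 (by
    refine ⟨by simpa using htx, ?_⟩
    rw [hhx]
    norm_num)))

variable [HasCentralRadical ℂ 𝔤] {H : LieSubalgebra ℂ 𝔤} [H.IsCartanSubalgebra] {I : Type*}
  [Fintype I] [DecidableEq I] {Δ : I → Module.Dual ℂ H} {X : Module.Dual ℂ H → 𝔤}
  {m : ℕ} {f : Fin m → I} {A : Matrix (Fin m) (Fin m) ℤ} {s : Fin m → Bool} {b : Fin m}

/-- The sign of a vertex as an integer. -/
def signInt (s : Fin m → Bool) (k : Fin m) : ℤ :=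
  if s k then 1 else -1

/-- The signed vertex `b` can be removed when the other vertices are the whole diagram, their root
vectors sum to the nilpositive element of an `sl₂`-triple whose neutral element acts on simple
roots through the integers `c`, and the root vector at `b` has weight `3`. -/
theorem areConjugate_of_sl2_certificate (hΔ : IsSimpleSystem Δ) (hX : IsRootVectors X)
    {P N : Finset I} (hPN : Disjoint P N) (hA : FormsDiagram Δ f A)
    (hf : Set.range f = Set.univ)
    (hs : ∀ k, if s k then f k ∈ P else f k ∈ N) (hsb : s b = false) (c : Fin m → ℤ)
    (hcb : c b = 0)
    (hmix : ∀ k l, k ≠ b → l ≠ b → k ≠ l → ReflectsToMixed A 1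
      (Pi.single k (signInt s k) - Pi.single l (signInt s l)))
    (hc : ∀ l, l ≠ b → ∑ k, c k * signInt s k * A k l * signInt s l = 2)
    (hc' : ∑ k, c k * signInt s k * A k b = -3) :
    AreConjugate (signedSum X Δ P N) (signedSum X Δ P (N \ {f b})) := by
  obtain ⟨t, ht⟩ := exists_coweight hΔ.linearIndependent
  have hbN : f b ∈ N := by simpa [hsb] using hs b
  have hsign (k : Fin m) : signOf P (f k) = signInt s k := by
    rw [signOf_eq hPN hs, signInt]
    split_ifs <;> simp
  obtain ⟨rt, hrt'⟩ : ∃ rt : Fin m → Module.Dual ℂ H,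
    ∀ k, rt k = weightOf Δ f (Pi.single k (signInt s k)) := ⟨_, fun _ ↦ rfl⟩
  have hrt (k : Fin m) : signOf P (f k) • Δ (f k) = rt k := by
    rw [hrt', weightOf_single, hsign]
  have hrtr (k : Fin m) : IsRoot (rt k) := hrt k ▸ isRoot_signOf_smul hΔ P (f k)
  obtain ⟨x, hxX⟩ : ∃ x : Fin m → 𝔤, ∀ k, x k = X (rt k) := ⟨_, fun _ ↦ rfl⟩
  have hx (k : Fin m) : x k ∈ rootSpace H (rt k) ∧ x k ≠ 0 := hxX k ▸ hX _ (hrtr k)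
  have hex (k : Fin m) := (hrtr k).exists_lie_lie_eq_smul (hx k).1 (hx k).2
  choose y hy hyz using hex
  let K : Finset (Fin m) := Finset.univ.erase b
  have hK {k : Fin m} (hk : k ∈ K) : k ≠ b := Finset.ne_of_mem_erase hk
  have hsum : signedSum X Δ P (N \ {f b}) = ∑ k ∈ K, x k := by
    have himg : P ∪ (N \ {f b}) = K.image f := by
      ext i
      obtain ⟨k, rfl⟩ : i ∈ Set.range f := hf ▸ Set.mem_univ i
      rw [mem_union_sdiff_iff hPN hA.1 hs hbN, hA.1.mem_finset_image]
      simp [K]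
    rw [signedSum_eq_sum X (hPN.mono_right Finset.sdiff_subset), himg, Finset.sum_image hA.1.injOn]
    exact Finset.sum_congr rfl fun k _ ↦ by rw [hrt, hxX]
  -- The difference of two distinct signed simple roots is not a root, by `hmix`, so only diagonal
  -- brackets survive in `⁅e, f'⁆`.
  have hcross {k l : Fin m} (hk : k ≠ b) (hl : l ≠ b) (hkl : k ≠ l) : ⁅x k, y l⁆ = 0 := by
    have h1 := lie_mem_rootSpace (hx k).1 (hy l)
    have h2 : rt k + -rt l = weightOf Δ f
        (Pi.single k (signInt s k) + Pi.single l (-signInt s l)) := by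
      rw [hrt', hrt', weightOf_add, weightOf_single, weightOf_single, weightOf_single,
        Int.cast_neg, neg_smul]
    have h3 := hmix k l hk hl hkl
    rw [sub_eq_add_neg, ← Pi.single_neg] at h3
    have h4 := h3.not_isRoot hΔ ht hA
    rw [h2] at h1
    refine eq_zero_of_not_isRoot (h := t (f k)) h4 ?_ h1
    rw [weightOf_apply_coweight hA.1 ht]
    simp only [Pi.add_apply, Pi.single_eq_same, Pi.single_eq_of_ne hkl, add_zero, signInt]
    split_ifs <;> simp
  obtain ⟨e, he⟩ : ∃ e, e = ∑ k ∈ K, x k := ⟨_, rfl⟩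
  obtain ⟨f', hf'⟩ : ∃ f', f' = ∑ k ∈ K, (c k : ℂ) • y k := ⟨_, rfl⟩
  have hef : ⁅e, f'⁆ = ∑ k ∈ K, (c k : ℂ) • ⁅x k, y k⁆ := by
    simp only [he, hf', sum_lie, lie_sum, lie_smul]
    refine Finset.sum_congr rfl fun k hk ↦ ?_
    rw [Finset.sum_eq_single_of_mem k hk]
    intro l hl hlk
    exact hcross (hK hl) (hK hk) hlk
  -- The neutral element acts as the combination of signed coroots with coefficients `c k`; as `c b
  -- = 0`, the vertex `b` may be included in the sum.
  have hact {v : Fin m → ℤ} {a : ℤ} (hv : ∃ k, v k ≠ 0)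
      (ha : ∑ k, c k * signInt s k * A.mulVec v k = a) {z : 𝔤}
      (hz : z ∈ rootSpace H (⇑(weightOf Δ f v))) : ⁅⁅e, f'⁆, z⁆ = (a : ℂ) • z := by
    obtain ⟨l, hl⟩ := hv
    by_cases hz0 : z = 0
    · simp [hz0]
    have hw0 : weightOf Δ f v ≠ 0 := fun h ↦ by
      have := LinearMap.congr_fun h (t (f l))
      rw [weightOf_apply_coweight hA.1 ht] at this
      exact hl (by simpa using this)
    have hwr : IsRoot (weightOf Δ f v) := ⟨hw0, lieSubmodule_ne_bot_iff.2 ⟨z, hz, hz0⟩⟩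
    have hco (k : Fin m) : weightOf Δ f v (coroot (rt k)) =
        (signInt s k * A.mulVec v k : ℤ) := by
      rw [← hrt, hsign, Int.cast_mul, ← weightOf_apply_coroot hA, signInt]
      split_ifs
      · simp
      · simp [(hΔ.isRoot (f k)).apply_coroot_neg hwr]
    rw [hef, sum_lie, ← ha, Int.cast_sum, Finset.sum_smul]
    rw [← Finset.add_sum_erase _ _ (Finset.mem_univ b), hcb]
    simp only [zero_mul, Int.cast_zero, zero_smul, zero_add]
    refine Finset.sum_congr rfl fun k _ ↦ ?_
    rw [smul_lie, hyz k _ hw0 z hz, hco, smul_smul, ← Int.cast_mul, mul_assoc]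
  have hsne (k : Fin m) : signInt s k ≠ 0 := by
    unfold signInt
    split_ifs <;> simp
  have hhx {l : Fin m} (hl : l ≠ b) : ⁅⁅e, f'⁆, x l⁆ = (2 : ℂ) • x l := by
    refine (hact (a := 2) ⟨l, by simpa using hsne l⟩ ?_ (hrt' l ▸ (hx l).1)).trans (by norm_num)
    rw [← hc l hl]
    simp [Matrix.mulVec_single, mul_assoc]
  have hhy {l : Fin m} (hl : l ≠ b) : ⁅⁅e, f'⁆, y l⁆ = (-2 : ℂ) • y l := by
    have h1 := hy l
    rw [show -rt l = weightOf Δ f (Pi.single l (-signInt s l)) by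
      rw [hrt', weightOf_single, weightOf_single, Int.cast_neg, neg_smul]] at h1
    refine (hact (a := -2) ⟨l, by simpa using hsne l⟩ ?_ h1).trans (by norm_num)
    rw [← hc l hl]
    simp [Matrix.mulVec_single, mul_assoc]
  have hxb : X (-Δ (f b)) = x b := by
    rw [hxX, ← hrt, hsign, signInt, hsb]
    simp
  have hhb : ⁅⁅e, f'⁆, x b⁆ = (3 : ℂ) • x b := by
    refine (hact (a := 3) ⟨b, by simpa using hsne b⟩ ?_ (hrt' b ▸ (hx b).1)).trans (by norm_num)
    rw [← neg_neg (3 : ℤ), ← hc']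
    simp [Matrix.mulVec_single, signInt, hsb]
  -- A zero neutral element could not have weight 3 on the nonzero vector `x b`.
  have hh0 : ⁅e, f'⁆ ≠ 0 := by
    intro h0
    rw [h0, zero_lie, eq_comm, smul_eq_zero] at hhb
    exact hhb.elim (by norm_num) (hx b).2
  have htriple : IsSl2Triple ⁅e, f'⁆ e f' := by
    refine ⟨hh0, rfl, ?_, ?_⟩
    · rw [← Nat.cast_smul_eq_nsmul ℂ]
      nth_rw 2 3 [he]
      rw [lie_sum, Finset.smul_sum]
      exact Finset.sum_congr rfl fun k hk ↦ by simpa using hhx (hK hk)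
    · rw [← Nat.cast_smul_eq_nsmul ℂ, ← neg_smul]
      nth_rw 2 3 [hf']
      rw [lie_sum, Finset.smul_sum]
      refine Finset.sum_congr rfl fun k hk ↦ ?_
      rw [lie_smul, hhy (hK hk), smul_comm]
      norm_num
  have htx (k : Fin m) : ⁅(t (f b) : 𝔤), x k⁆ =
      ((Pi.single k (signInt s k) : Fin m → ℤ) b : ℂ) • x k := by
    rw [lie_eq_smul_of_mem_rootSpace (hrtr k).1 (hx k).1 (t (f b)), hrt',
      weightOf_apply_coweight hA.1 ht]
  have hty {k : Fin m} (hk : k ≠ b) : ⁅(t (f b) : 𝔤), y k⁆ = 0 := by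
    rw [lie_eq_smul_of_mem_rootSpace (neg_ne_zero.2 (hrtr k).1) (hy k) (t (f b)),
      LinearMap.neg_apply, hrt', weightOf_apply_coweight hA.1 ht, Pi.single_eq_of_ne hk.symm]
    simp
  rw [signedSum_eq_add (Δ := Δ) (X := X) (P := P) hbN, hsum, hxb, ← he]
  refine areConjugate_add_of_isSl2Triple htriple (t := (t (f b) : 𝔤)) ?_ ?_ ?_ hhb
  · rw [he, lie_sum, Finset.sum_eq_zero fun k hk ↦ by
      rw [htx, Pi.single_eq_of_ne (hK hk).symm, Int.cast_zero, zero_smul]]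
  · rw [hf', lie_sum, Finset.sum_eq_zero fun k hk ↦ by rw [lie_smul, hty (hK hk), smul_zero]]
  · rw [htx, Pi.single_eq_same, signInt, hsb]
    simp

end

/-! ### The five patterns and the exchange of signs -/

section

variable {𝔤 : Type*} [LieRing 𝔤] [LieAlgebra ℂ 𝔤] [FiniteDimensional ℂ 𝔤]
  [HasCentralRadical ℂ 𝔤] {H : LieSubalgebra ℂ 𝔤} [H.IsCartanSubalgebra] {I : Type*}
  [Fintype I] [DecidableEq I] {Δ : I → Module.Dual ℂ H} {X : Module.Dual ℂ H → 𝔤}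
  {P N : Finset I} {β : I}

theorem Pattern.areConjugate (hΔ : IsSimpleSystem Δ) (hX : IsRootVectors X) (hPN : Disjoint P N)
    (h : Pattern Δ P N β) :
    AreConjugate (signedSum X Δ P N) (signedSum X Δ P (N \ {β})) := by
  cases h with
  | A₂ α β hα hβ type nbr =>
    exact Killable.areConjugate (s := ![true, false]) (b := 1) hΔ hX hPN type nbr
      (by simp [Fin.forall_fin_succ, hα, hβ]) rfl (n := 1) (by decide +kernel)
  | A₄ α₁ α₂ β₁ β₂ hα hβ type nbr =>
    simp only [Finset.insert_subset_iff, Finset.singleton_subset_iff] at hα hβ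
    exact Killable.areConjugate (s := ![true, true, false, false]) (b := 2) hΔ hX hPN type nbr
      (by simp [Fin.forall_fin_succ, hα, hβ]) rfl (n := 2) (by decide +kernel)
  | A₆ α₁ α₂ α₃ β₁ β₂ β₃ hα hβ type nbr =>
    simp only [Finset.insert_subset_iff, Finset.singleton_subset_iff] at hα hβ
    exact Killable.areConjugate (s := ![true, true, true, false, false, false]) (b := 3) hΔ hX hPN
      type nbr (by simp [Fin.forall_fin_succ, hα, hβ]) rfl (n := 3) (by decide +kernel)
  | E₆ β₁ β₂ β₃ α₁ α₂ α₃ hα hβ type nbr nbr₁ =>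
    simp only [Finset.insert_subset_iff, Finset.singleton_subset_iff] at hα hβ
    exact Killable.areConjugate (s := ![false, false, false, true, true, true]) (b := 1) hΔ hX hPN
      type nbr (by simp [Fin.forall_fin_succ, hα, hβ]) rfl (n := 3) (by decide +kernel)
  | E₈ α₁ α₂ α₃ α₄ α₅ α₆ α₇ α₈ type all hP hN =>
    exact areConjugate_of_sl2_certificate
      (s := ![true, true, true, true, false, false, false, false]) (b := 4) hΔ hX hPN type all
      -- Without vertex 5 the diagram splits into A₄ (chain 1-3-4-2) and A₃ (chain 6-7-8). The
      -- entries are the coefficients of the sum of positive coroots: 4, 6, 6, 4 and 3, 4, 3. On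
      -- `-α₅` the signed sum takes the value 6 - 3 = 3.
      (by simp [Fin.forall_fin_succ, hP, hN]) rfl ![4, 4, 6, 6, 0, 3, 4, 3] rfl
      (by decide +kernel) (by decide +kernel) (by decide +kernel)

lemma IsSimpleSystem.neg (hΔ : IsSimpleSystem Δ) : IsSimpleSystem (-Δ) where
  isRoot i := (hΔ.isRoot i).neg
  linearIndependent := by
    have := hΔ.linearIndependent.units_smul fun _ ↦ (-1 : ℂˣ)
    convert this using 1
    ext i
    simp
  pos_or_neg β hβ := by
    obtain ⟨n, h⟩ := hΔ.pos_or_neg β hβ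
    exact ⟨n, by simpa [or_comm] using h⟩

lemma IsSimpleSystem.cartanInt_neg (hΔ : IsSimpleSystem Δ) : cartanInt (-Δ) = cartanInt Δ := by
  ext i j
  simp [cartanInt, (hΔ.isRoot i).apply_coroot_neg (hΔ.isRoot j)]

lemma FormsDiagram.congr {Δ' : I → Module.Dual ℂ H} (h : cartanInt Δ' = cartanInt Δ) {m : ℕ}
    {f : Fin m → I} {A : Matrix (Fin m) (Fin m) ℤ} (hA : FormsDiagram Δ f A) :
    FormsDiagram Δ' f A := by
  rwa [FormsDiagram, h]

lemma NeighboursIn.congr {Δ' : I → Module.Dual ℂ H} (h : cartanInt Δ' = cartanInt Δ) {m : ℕ}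
    {f : Fin m → I} (hf : NeighboursIn Δ f P) : NeighboursIn Δ' f P := by
  simpa only [NeighboursIn, Connected, h] using hf

/-- The patterns only depend on the Cartan matrix. -/
lemma Pattern.congr {Δ' : I → Module.Dual ℂ H} (h : cartanInt Δ' = cartanInt Δ)
    (hp : Pattern Δ P N β) : Pattern Δ' P N β := by
  cases hp with
  | A₂ _ _ hα hβ type nbr => exact .A₂ _ _ hα hβ (type.congr h) (nbr.congr h)
  | A₄ _ _ _ _ hα hβ type nbr => exact .A₄ _ _ _ _ hα hβ (type.congr h) (nbr.congr h)
  | A₆ _ _ _ _ _ _ hα hβ type nbr => exact .A₆ _ _ _ _ _ _ hα hβ (type.congr h) (nbr.congr h)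
  | E₆ _ _ _ _ _ _ hα hβ type nbr nbr₁ =>
    exact .E₆ _ _ _ _ _ _ hα hβ (type.congr h) (nbr.congr h)
      (by simpa only [Connected, h] using nbr₁)
  | E₈ _ _ _ _ _ _ _ _ type all hP hN =>
    exact .E₈ _ _ _ _ _ _ _ _ (type.congr h) all hP hN

omit [FiniteDimensional ℂ 𝔤] [HasCentralRadical ℂ 𝔤] [H.IsCartanSubalgebra] [Fintype I]
  [DecidableEq I] in
lemma signedSum_neg : signedSum X (-Δ) N P = signedSum X Δ P N := by
  simp [signedSum, add_comm]

end

end LiePattern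

end

theorem lemma7p1 {𝔤 : Type*} [LieRing 𝔤] [LieAlgebra ℂ 𝔤] [FiniteDimensional ℂ 𝔤]
    [LieAlgebra.HasCentralRadical ℂ 𝔤]
    (H : LieSubalgebra ℂ 𝔤) [H.IsCartanSubalgebra]
    {I : Type*} [Fintype I] [DecidableEq I]
    (Δ : I → Module.Dual ℂ H) (hΔ : LiePattern.IsSimpleSystem Δ)
    (hsl : LiePattern.IsSimplyLaced Δ)
    (X : Module.Dual ℂ H → 𝔤) (hX : LiePattern.IsRootVectors X)
    (J₁ J₂ : Finset I) (hJ : Disjoint J₁ J₂) (β : I) :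
    (LiePattern.Pattern Δ J₁ J₂ β →
      LiePattern.AreConjugate
        (LiePattern.signedSum X Δ J₁ J₂) (LiePattern.signedSum X Δ J₁ (J₂ \ {β}))) ∧
    (LiePattern.Pattern Δ J₂ J₁ β →
      LiePattern.AreConjugate
        (LiePattern.signedSum X Δ J₁ J₂) (LiePattern.signedSum X Δ (J₁ \ {β}) J₂)) := by
  refine ⟨fun h ↦ h.areConjugate hΔ hX hJ, fun h ↦ ?_⟩
  -- Negating `Δ` swaps the labels and leaves the Cartan integers, hence the patterns, unchanged.
  simpa only [LiePattern.signedSum_neg] using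
    (h.congr hΔ.cartanInt_neg).areConjugate hΔ.neg hX hJ.symm
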